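/- **Setting.** Let $P\in\mathbb R^{d\times n}$ have $\mathbb Q$-linearly independent columns, let $\mathbb T^n=(\mathbb R/2\pi\mathbb Z)^n$ carry its normalized Haar measure, and let $|\cdot|$ denote Euclidean norms. For $s\in\mathbb R$ let $\overline H^s_{P,0}(\mathbb T^n)$ be the space of formal Fourier series $U=\sum_{k\in\mathbb Z^n\setminus\{0\}}\widehat U_k e^{\mathrm i k^\top y}$ with complex coefficients and $$\|U\|_{\overline H^s_{P,0}}:=\Big(\sum_{k\in\mathbb Z^n\setminus\{0\}}|Pk|^{2s}|\widehat U_k|^2\Big)^{1/2}<\infty .$$ For a bounded real function $A$ on $\mathbb T^n$ and $U,V\in\overline H^1_{P,0}(\mathbb T^n)$ put $a(U,V):=\int_{\mathbb T^n}A\,(P\nabla U)\cdot\overline{(P\nabla V)}$, where $P\nabla U=\sum_{k\neq0}\mathrm i\,Pk\,\widehat U_k e^{\mathrm i k^\top y}\in L^2(\mathbb T^n)^d$, and for $F\in\overline H^{-1}_{P,0}(\mathbb T^n)$ put $\langle F,V\rangle:=\sum_{k\ne0}\widehat F_k\overline{\widehat V_k}$. The periodic variational problem is: find $U\in\overline H^1_{P,0}(\mathbb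 T^n)$ with $a(U,V)=\langle F,V\rangle$ for all $V\in\overline H^1_{P,0}(\mathbb T^n)$. **Theorem.** Let $A:\mathbb T^n\to\mathbb R$ satisfy $0<\alpha_0\le A(y)\le\alpha_1<\infty$ for all $y\in\mathbb T^n$, and suppose that $|\widehat A_k|\le C_A(1+|k|)^{-N}$ for all $k\in\mathbb Z^n$, with a constant $C_A>0$ and a real number $N>n+m+1$, where $m\ge0$ is an integer. Then for every $F\in\overline H^{-1}_{P,0}(\mathbb T^n)\cap\overline H^{m}_{P,0}(\mathbb T^n)$ the periodic variational problem has a unique solution $U\in\overline H^1_{P,0}(\mathbb T^n)$; this solution belongs to $\overline H^1_{P,0}(\mathbb T^n)\cap\overline H^{m+2}_{P,0}(\mathbb T^n)$, and $$\|U\|_{\overline H^{m+2}_{P,0}}\le C_m\big(\|F\|_{\overline H^{-1}_{P,0}}+\|F\|_{\overline H^{m}_{P,0}}\big).$$ Here, with $C_\lambda:=\sqrt{\lambda_{\max}(P^\top P)}$ and $C_{\lambda,A,j}:=C_\lambda^{\,j}\,C_A\sum_{k\in\mathbb Z^n}(1+|k|)^{j-N}$, the constants are defined recursively by $C_m=\alpha_0^{-1}\sqrt{(m+1)!}\,\sqrt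 d\,M_m$, $M_0=\max\{\alpha_0^{-1}C_{\lambda,A,1},\,1\}$ and, for $m\ge1$, $$M_m=\max\Big\{\alpha_0^{-1}C_{\lambda,A,m+1}+2\sum_{j=1}^m\sqrt{\tbinom{j+d-1}{d-1}}\,C_{\lambda,A,m+1-j}\,C_{j-1},\ \ 1+\sum_{j=1}^m\sqrt{\tbinom{j+d-1}{d-1}}\,C_{\lambda,A,m+1-j}\,C_{j-1}\Big\}.$$ -/

import Mathlib

open MeasureTheory Real
open scoped Nat ComplexConjugate

noncomputable section

namespace Quasiperiodic

/-- The torus `𝕋ⁿ = (ℝ / 2πℤ)ⁿ`. -/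
abbrev Torus (n : ℕ) : Type := Fin n → AddCircle (2 * π)

/-- The period `2π` is positive (needed for the Haar measure of `ℝ / 2πℤ`). -/
instance factTwoPiPos : Fact (0 < 2 * π) := ⟨Real.two_pi_pos⟩

/-- The normalized (total mass one) Haar measure of the torus. -/
def torusMeasure (n : ℕ) : Measure (Torus n) :=
  Measure.pi fun _ => (AddCircle.haarAddCircle : Measure (AddCircle (2 * π)))

instance instProbTorusMeasure (n : ℕ) : IsProbabilityMeasure (torusMeasure n) := by
  unfold torusMeasure; infer_instance

/-- The trigonometric mode `y ↦ exp(i k·y) = ∏ⱼ exp(i kⱼ yⱼ)`, `k ∈ ℤⁿ`. -/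
def mode {n : ℕ} (k : Fin n → ℤ) : C(Torus n, ℂ) where
  toFun y := ∏ i, fourier (k i) (y i)
  continuous_toFun := by fun_prop

/-- The Fourier coefficient `Â_k = ∫ A(y) exp(-i k·y) dy` of a real function on the torus. -/
def fourierCoeffTorus {n : ℕ} (A : Torus n → ℝ) (k : Fin n → ℤ) : ℂ :=
  ∫ y, (A y : ℂ) * conj (mode k y) ∂(torusMeasure n)

/-- The sum `∑ₖ cₖ exp(i k·y)` in `L²(𝕋ⁿ)` of a Fourier series with square summable
coefficients. -/
def seriesL2 {n : ℕ} (c : (Fin n → ℤ) → ℂ) : Lp ℂ 2 (torusMeasure n) :=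
  ∑' k, c k • ContinuousMap.toLp 2 (torusMeasure n) ℂ (mode k)

/-- The Euclidean length `|k|` of `k ∈ ℤⁿ`. -/
def freqNorm {n : ℕ} (k : Fin n → ℤ) : ℝ :=
  ‖(WithLp.toLp 2 (fun i => (k i : ℝ)) : EuclideanSpace ℝ (Fin n))‖

/-- `ℙ^{d×n}`: the real matrices whose columns are linearly independent over `ℚ`. -/
def IsProjectionMatrix {d n : ℕ} (P : Matrix (Fin d) (Fin n) ℝ) : Prop :=
  LinearIndependent ℚ fun j : Fin n => P.col j

/-- The projected frequency `P k ∈ ℝᵈ`, `k ∈ ℤⁿ`. -/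
def projFreq {d n : ℕ} (P : Matrix (Fin d) (Fin n) ℝ) (k : Fin n → ℤ) :
    EuclideanSpace ℝ (Fin d) :=
  WithLp.toLp 2 (P.mulVec fun i => (k i : ℝ))

/-- The homogeneous zero-mean projected Sobolev space: all formal Fourier series
`U = ∑_{k ≠ 0} Û_k exp(i k·y)` with `∑_{k ≠ 0} |P k|^{2s} |Û_k|² < ∞`. A series is given by its
coefficients `U k = Û_k`, `U 0 = 0`. -/
def HBar {d n : ℕ} (P : Matrix (Fin d) (Fin n) ℝ) (s : ℝ) :
    Submodule ℂ ((Fin n → ℤ) → ℂ) where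
  carrier := {U | U 0 = 0 ∧
    Summable fun k : {k : Fin n → ℤ // k ≠ 0} => ‖projFreq P k‖ ^ (2 * s) * ‖U k‖ ^ 2}
  zero_mem' := by simp [summable_zero]
  add_mem' := by
    rintro U V ⟨hU0, hU⟩ ⟨hV0, hV⟩
    refine ⟨by simp [hU0, hV0], ?_⟩
    refine Summable.of_nonneg_of_le (fun k => by positivity) (fun k => ?_)
      ((hU.add hV).mul_left 2)
    have h1 : ‖(U + V) k‖ ^ 2 ≤ 2 * (‖U k‖ ^ 2 + ‖V k‖ ^ 2) := by
      have h := norm_add_le (U k) (V k)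
      have h0 := norm_nonneg (U k + V k)
      simp only [Pi.add_apply]
      nlinarith [sq_nonneg (‖U k‖ - ‖V k‖)]
    have h2 : 0 ≤ ‖projFreq P (k : Fin n → ℤ)‖ ^ (2 * s) := by positivity
    nlinarith [mul_le_mul_of_nonneg_left h1 h2]
  smul_mem' := by
    rintro c U ⟨hU0, hU⟩
    refine ⟨by simp [hU0], ?_⟩
    refine (hU.mul_left (‖c‖ ^ 2)).congr fun k => ?_
    simp only [Pi.smul_apply, smul_eq_mul, norm_mul]
    ring

/-- The norm `(∑_{k ≠ 0} |P k|^{2s} |Û_k|²)^{1/2}` of `HBar P s`. -/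
def hNorm {d n : ℕ} (P : Matrix (Fin d) (Fin n) ℝ) (s : ℝ) (U : (Fin n → ℤ) → ℂ) : ℝ :=
  √(∑' k : {k : Fin n → ℤ // k ≠ 0}, ‖projFreq P k‖ ^ (2 * s) * ‖U k‖ ^ 2)

/-- The Fourier coefficients `i (P k)_j Û_k` of the `j`-th component of `P ∇ U`. -/
def projGradCoeff {d n : ℕ} (P : Matrix (Fin d) (Fin n) ℝ) (U : (Fin n → ℤ) → ℂ) (j : Fin d) :
    (Fin n → ℤ) → ℂ :=
  fun k => Complex.I * (projFreq P k j : ℂ) * U k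

/-- The energy form `a(U, V) = (A P∇U, P∇V) = ∫ A (P∇U) · conj (P∇V)`. For `U, V` in `HBar P 1`
the components of `P∇U` and `P∇V` are functions in `L²(𝕋ⁿ)`. -/
def energyForm {d n : ℕ} (P : Matrix (Fin d) (Fin n) ℝ) (A : Torus n → ℝ)
    (U V : (Fin n → ℤ) → ℂ) : ℂ :=
  ∑ j : Fin d, ∫ y, (A y : ℂ) * seriesL2 (projGradCoeff P U j) y
    * conj (seriesL2 (projGradCoeff P V j) y) ∂(torusMeasure n)

/-- The duality pairing `⟨F, V⟩ = ∑_{k ≠ 0} F̂_k conj(V̂_k)` of `HBar P (-1)` and `HBar P 1`. -/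
def pairing {n : ℕ} (F V : (Fin n → ℤ) → ℂ) : ℂ :=
  ∑' k : {k : Fin n → ℤ // k ≠ 0}, F k * conj (V k)

/-- `U` solves the periodic variational problem: `U ∈ HBar P 1` and `a(U, V) = ⟨F, V⟩` for all
`V ∈ HBar P 1`. -/
def IsVariationalSolution {d n : ℕ} (P : Matrix (Fin d) (Fin n) ℝ) (A : Torus n → ℝ)
    (F U : (Fin n → ℤ) → ℂ) : Prop :=
  U ∈ HBar P 1 ∧ ∀ V ∈ HBar P 1, energyForm P A U V = pairing F V

/-- `C_λ = √(λ_max(Pᵀ P))`. -/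
def lambdaConst {d n : ℕ} (P : Matrix (Fin d) (Fin n) ℝ) : ℝ :=
  √(sSup (spectrum ℝ (P.transpose * P)))

/-- `C_{λ,A,j} = C_λ^j C_A ∑_{k ∈ ℤⁿ} (1 + |k|)^{j - N}`. -/
def derivConst {d n : ℕ} (P : Matrix (Fin d) (Fin n) ℝ) (CA N : ℝ) (j : ℕ) : ℝ :=
  lambdaConst P ^ j * CA * ∑' k : Fin n → ℤ, (1 + freqNorm k) ^ ((j : ℝ) - N)

/-- The constants `C_m`, for given `d`, `α₀` and `c j = C_{λ,A,j}`, by strong recursion on `m`.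
The summation index `j : Fin m` stands for `j + 1 ∈ {1, …, m}`; the lemmas below give the
recursion in its usual form. -/
def regConst (d : ℕ) (α₀ : ℝ) (c : ℕ → ℝ) : ℕ → ℝ
  | m => α₀⁻¹ * √((m + 1)! : ℝ) * √(d : ℝ) *
      max (α₀⁻¹ * c (m + 1) + 2 * ∑ j : Fin m,
            √((((j : ℕ) + 1) + d - 1).choose (d - 1) : ℝ) * c (m + 1 - ((j : ℕ) + 1))
              * regConst d α₀ c j)
          (1 + ∑ j : Fin m,
            √((((j : ℕ) + 1) + d - 1).choose (d - 1) : ℝ) * c (m + 1 - ((j : ℕ) + 1))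
              * regConst d α₀ c j)
  decreasing_by all_goals exact j.2

/-- The constants `M_m` for `m ≥ 1` (for `m = 0` the sums are empty). -/
def regM (d : ℕ) (α₀ : ℝ) (c : ℕ → ℝ) (m : ℕ) : ℝ :=
  max (α₀⁻¹ * c (m + 1) + 2 * ∑ j ∈ Finset.Icc 1 m,
        √((j + d - 1).choose (d - 1) : ℝ) * c (m + 1 - j) * regConst d α₀ c (j - 1))
      (1 + ∑ j ∈ Finset.Icc 1 m,
        √((j + d - 1).choose (d - 1) : ℝ) * c (m + 1 - j) * regConst d α₀ c (j - 1))

theorem regM_zero (d : ℕ) (α₀ : ℝ) (c : ℕ → ℝ) : regM d α₀ c 0 = max (α₀⁻¹ * c 1) 1 := by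
  simp [regM]

theorem regConst_eq (d : ℕ) (α₀ : ℝ) (c : ℕ → ℝ) (m : ℕ) :
    regConst d α₀ c m = α₀⁻¹ * √((m + 1)! : ℝ) * √(d : ℝ) * regM d α₀ c m := by
  have key : ∀ f : ℕ → ℝ, ∑ j ∈ Finset.Icc 1 m, f j = ∑ j : Fin m, f ((j : ℕ) + 1) := by
    intro f
    rw [Fin.sum_univ_eq_sum_range (fun j => f (j + 1)) m, Finset.range_eq_Ico,
      Finset.sum_Ico_add' f 0 m 1]
    rfl
  rw [regConst, regM, key]
  rfl

end Quasiperiodic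

end

noncomputable section

namespace Quasiperiodic

open scoped InnerProductSpace ENNReal

/-! On the Fourier side A acts by convolution and P∇ by the multiplier i Pk, so a(U, V) is an
absolutely convergent double series (`HasL2Grad.hasSum_energyForm`). The form is coercive for the
gradient norm, and Pk ≠ 0 for k ≠ 0. Hence Lax–Milgram on ℓ² gradient coefficients gives existence
(`exists_energyForm_eq`), and coercivity gives uniqueness and ‖U‖₁ ≤ α₀⁻¹‖F‖₋₁. No lower bound on
|Pk| is needed, because all norms are homogeneous.

Regularity comes from testing with w²U, where w(k) = min(|Pk|, R)^(m+1). Then a(wU, wU) equals a(U,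
w²U) minus a commutator whose kernel contains Â_p (w(l+p) − w(l)). Binomial expansion and Young's
inequality bound the commutator by ‖wU‖₁ times a combination of ‖U‖₁, …, ‖U‖_{m+1}, uniformly in R
(`gradNorm_truncWeight_mul_le`). Removing the truncation bounds ‖U‖_{m+2} by ‖F‖_m and lower norms
of U, and strong induction closes the estimate.

For the stated constants, the binomials C(m+1, j) must be absorbed into √((m+1)!). For m ≥ 4 they
are small enough. For m = 1, 2, 3 they are not, and interpolation of ‖F‖_i between orders −1 and m
supplies what is missing (`exists_interpolation_weights`, `le_regConst_mul`). -/

/-- The trigonometric modes as elements of `L²`. -/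
abbrev modeLp {n : ℕ} (k : Fin n → ℤ) : Lp ℂ 2 (torusMeasure n) :=
  ContinuousMap.toLp 2 (torusMeasure n) ℂ (mode k)

/-! ### Characters of the torus and Parseval's identity. -/

theorem mode_add {n : ℕ} (k l : Fin n → ℤ) (y : Torus n) :
    mode (k + l) y = mode k y * mode l y := by
  simp [mode, Finset.prod_mul_distrib]

theorem mode_neg {n : ℕ} (k : Fin n → ℤ) (y : Torus n) :
    mode (-k) y = conj (mode k y) := by
  simp only [mode, Pi.neg_apply, fourier_neg, ContinuousMap.coe_mk, map_prod]

/-- The integral factors over the coordinates, and a coordinate where the frequencies differ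
contributes a vanishing factor. -/
theorem orthonormal_modeLp (n : ℕ) : Orthonormal ℂ (modeLp (n := n)) := by
  rw [orthonormal_iff_ite]
  intro k l
  simp only [ContinuousMap.inner_toLp, ← mode_neg, ← mode_add]
  split_ifs with h
  · simp [h, mode]
  · simp only [mode, ContinuousMap.coe_mk, torusMeasure]
    rw [integral_fintype_prod_eq_prod (𝕜 := ℂ)
      (f := fun i (y : AddCircle (2 * π)) => fourier ((l + -k) i) y)]
    obtain ⟨i, hi⟩ := Function.ne_iff.mp h
    apply Finset.prod_eq_zero (Finset.mem_univ i)
    simpa only [eq_false_intro hi, if_false, ContinuousMap.inner_toLp, ← fourier_neg,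
      ← fourier_add] using! (orthonormal_iff_ite.mp <| orthonormal_fourier) (k i) (l i)

theorem hasSum_seriesL2 {n : ℕ} {c : (Fin n → ℤ) → ℂ} (hc : Summable fun k => ‖c k‖ ^ 2) :
    HasSum (fun k => c k • modeLp k) (seriesL2 c) := by
  refine Summable.hasSum ?_
  have := (orthonormal_modeLp n).orthogonalFamily.summable_iff_norm_sq_summable c
  simpa using this.2 hc

/-- Parseval's identity for a square summable trigonometric series. -/
theorem norm_sq_seriesL2 {n : ℕ} {c : (Fin n → ℤ) → ℂ} (hc : Summable fun k => ‖c k‖ ^ 2) :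
    ‖seriesL2 c‖ ^ 2 = ∑' k, ‖c k‖ ^ 2 := by
  have h := hasSum_seriesL2 hc
  have h1 := h.mapL (innerSL ℂ (seriesL2 c))
  have h2 : ∀ k, ⟪seriesL2 c, c k • modeLp k⟫_ℂ = ((‖c k‖ ^ 2 : ℝ) : ℂ) := by
    intro k
    have h3 : HasSum (fun l => ⟪modeLp k, c l • modeLp l⟫_ℂ) ⟪modeLp k, seriesL2 c⟫_ℂ :=
      h.mapL (innerSL ℂ (modeLp k))
    have h4 : ⟪modeLp k, seriesL2 c⟫_ℂ = c k := by
      rw [← h3.tsum_eq, tsum_eq_single k]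
      · rw [inner_smul_right, orthonormal_iff_ite.1 (orthonormal_modeLp n)]; simp
      · intro l hl
        rw [inner_smul_right, orthonormal_iff_ite.1 (orthonormal_modeLp n), if_neg hl.symm,
          mul_zero]
    rw [inner_smul_right, ← inner_conj_symm, h4, RCLike.mul_conj]
    norm_cast
  simp only [innerSL_apply_apply, h2] at h1
  have h5 := h1.tsum_eq
  rw [inner_self_eq_norm_sq_to_K, ← Complex.ofReal_tsum] at h5
  change _ = ((‖seriesL2 c‖ : ℝ) : ℂ) ^ 2 at h5
  exact_mod_cast h5.symm

/-! ### Multiplication by A on L². -/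

section Multiplier

variable {n : ℕ} {A : Torus n → ℝ} {α₀ α₁ : ℝ}

theorem memLp_top_ofReal (hA : AEMeasurable A (torusMeasure n))
    (hb : ∀ y, ‖A y‖ ≤ α₁) : MemLp (fun y => (A y : ℂ)) ∞ (torusMeasure n) := by
  refine memLp_top_of_bound (Complex.measurable_ofReal.comp_aemeasurable hA).aestronglyMeasurable
    α₁ (Filter.Eventually.of_forall fun y => ?_)
  simpa using hb y

/-- Multiplication by a bounded real function, as an operator on `L²(𝕋ⁿ)`. -/
theorem exists_multiplier (hA : AEMeasurable A (torusMeasure n))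
    (hb : ∀ y, ‖A y‖ ≤ α₁) :
    ∃ M : Lp ℂ 2 (torusMeasure n) →L[ℂ] Lp ℂ 2 (torusMeasure n),
      ∀ f g : Lp ℂ 2 (torusMeasure n),
        ⟪g, M f⟫_ℂ = ∫ y, (A y : ℂ) * f y * conj (g y) ∂(torusMeasure n) := by
  have hm := memLp_top_ofReal hA hb
  refine ⟨(ContinuousLinearMap.mul ℂ ℂ).holderL (torusMeasure n) ∞ 2 2 (hm.toLp _), ?_⟩
  intro f g
  rw [L2.inner_def]
  refine integral_congr_ae ?_
  have h1 := (ContinuousLinearMap.mul ℂ ℂ).coeFn_holder (r := 2) (hm.toLp _) f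
  filter_upwards [h1, hm.coeFn_toLp] with y h1 h2
  change ⟪g y, ((ContinuousLinearMap.mul ℂ ℂ).holder 2 (hm.toLp _) f) y⟫_ℂ = _
  rw [h1, h2]
  simp

theorem integral_mul_mode {n : ℕ} (A : Torus n → ℝ) (k l : Fin n → ℤ) :
    ∫ y, (A y : ℂ) * modeLp l y * conj (modeLp k y) ∂(torusMeasure n) =
      fourierCoeffTorus A (k - l) := by
  refine integral_congr_ae ?_
  filter_upwards [ContinuousMap.coeFn_toLp (p := 2) (𝕜 := ℂ) (torusMeasure n) (mode k),
    ContinuousMap.coeFn_toLp (p := 2) (𝕜 := ℂ) (torusMeasure n) (mode l)] with y h1 h2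
  rw [h1, h2, ← mode_neg, ← mode_neg, mul_assoc, ← mode_add]
  congr 2
  simp [sub_eq_add_neg]

theorem le_integral_mul_norm_sq (hA : AEMeasurable A (torusMeasure n))
    (hAb : ∀ y, α₀ ≤ A y ∧ A y ≤ α₁) (f : Lp ℂ 2 (torusMeasure n)) :
    α₀ * ‖f‖ ^ 2 ≤ (∫ y, (A y : ℂ) * f y * conj (f y) ∂(torusMeasure n)).re := by
  have hI : Integrable (fun y => ‖f y‖ ^ 2) (torusMeasure n) := by
    exact (memLp_two_iff_integrable_sq_norm (Lp.memLp f).1).1 (Lp.memLp f)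
  have h1 : ‖f‖ ^ 2 = ∫ y, ‖f y‖ ^ 2 ∂(torusMeasure n) := by
    have h := L2.inner_def (𝕜 := ℂ) f f
    rw [inner_self_eq_norm_sq_to_K] at h
    have h2 : ∀ y, ⟪f y, f y⟫_ℂ = ((‖f y‖ ^ 2 : ℝ) : ℂ) := fun y => by
      rw [inner_self_eq_norm_sq_to_K]; norm_cast
    simp only [h2] at h
    rw [integral_complex_ofReal] at h
    change ((‖f‖ : ℝ) : ℂ) ^ 2 = _ at h
    exact_mod_cast h
  have h2 : ∀ y, (A y : ℂ) * f y * conj (f y) = ((A y * ‖f y‖ ^ 2 : ℝ) : ℂ) := fun y => by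
    rw [mul_assoc, RCLike.mul_conj]; push_cast; rfl
  simp only [h2]
  rw [integral_complex_ofReal, Complex.ofReal_re, h1, ← integral_const_mul]
  refine integral_mono (hI.const_mul _) ?_ fun y =>
    mul_le_mul_of_nonneg_right (hAb y).1 (by positivity)
  refine hI.bdd_mul (c := max |α₀| |α₁|) hA.aestronglyMeasurable
    (Filter.Eventually.of_forall fun y => ?_)
  rw [Real.norm_eq_abs]
  exact abs_le_max_abs_abs (hAb y).1 (hAb y).2

end Multiplier

/-! ### Convolution inequalities and the double series of ∫ A f ḡ. -/

/-- The Cauchy–Schwarz inequality for series with nonnegative terms. -/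
theorem summable_mul_and_tsum_mul_le_sqrt {ι : Type*} {x y : ι → ℝ} (hx0 : ∀ i, 0 ≤ x i)
    (hy0 : ∀ i, 0 ≤ y i) (hx : Summable fun i => x i ^ 2) (hy : Summable fun i => y i ^ 2) :
    (Summable fun i => x i * y i) ∧
      ∑' i, x i * y i ≤ √(∑' i, x i ^ 2) * √(∑' i, y i ^ 2) := by
  have h := Real.summable_and_inner_le_Lp_mul_Lq_tsum_of_nonneg Real.HolderConjugate.two_two
    hx0 hy0 (by simpa using hx) (by simpa using hy)
  simpa [Real.sqrt_eq_rpow] using h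

/-- Young's inequality for convolutions, in its trilinear form on an additive group. -/
theorem summable_convolution_and_tsum_le {G : Type*} [AddGroup G] {b x y : G → ℝ}
    (hb0 : ∀ i, 0 ≤ b i) (hx0 : ∀ i, 0 ≤ x i) (hy0 : ∀ i, 0 ≤ y i) (hb : Summable b)
    (hx : Summable fun i => x i ^ 2) (hy : Summable fun i => y i ^ 2) :
    (Summable fun q : G × G => b q.1 * x q.2 * y (q.2 + q.1)) ∧
      ∑' q : G × G, b q.1 * x q.2 * y (q.2 + q.1) ≤
        (∑' p, b p) * √(∑' i, x i ^ 2) * √(∑' i, y i ^ 2) := by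
  have hys : ∀ p, Summable fun l => y (l + p) ^ 2 := fun p =>
    (Equiv.addRight p).summable_iff (f := fun l => y l ^ 2) |>.2 hy
  have hyt : ∀ p, ∑' l, y (l + p) ^ 2 = ∑' l, y l ^ 2 := fun p =>
    (Equiv.addRight p).tsum_eq (fun l => y l ^ 2)
  have key := fun p => summable_mul_and_tsum_mul_le_sqrt hx0 (fun l => hy0 (l + p)) hx (hys p)
  have hin : ∀ p, ∑' l, b p * x l * y (l + p) ≤
      b p * (√(∑' i, x i ^ 2) * √(∑' i, y i ^ 2)) := fun p => by
    simp only [mul_assoc, tsum_mul_left]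
    have := (key p).2
    rw [hyt] at this
    exact mul_le_mul_of_nonneg_left this (hb0 p)
  have hsum : Summable fun p => ∑' l, b p * x l * y (l + p) :=
    Summable.of_nonneg_of_le
      (fun p => tsum_nonneg fun l => mul_nonneg (mul_nonneg (hb0 p) (hx0 l)) (hy0 _)) hin
      (hb.mul_right _)
  have hS : Summable fun q : G × G => b q.1 * x q.2 * y (q.2 + q.1) := by
    refine (summable_prod_of_nonneg fun q =>
      mul_nonneg (mul_nonneg (hb0 q.1) (hx0 q.2)) (hy0 _)).2 ⟨fun p => ?_, hsum⟩
    simpa only [mul_assoc] using (key p).1.mul_left (b p)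
  refine ⟨hS, ?_⟩
  rw [hS.tsum_prod, mul_assoc, ← tsum_mul_right]
  exact hsum.tsum_le_tsum hin (hb.mul_right _)

/-- The shear `(p, l) ↦ (l + p, l)` of the square of an additive group. -/
def shearEquiv (G : Type*) [AddGroup G] : G × G ≃ G × G where
  toFun q := (q.2 + q.1, q.2)
  invFun r := (-r.2 + r.1, r.2)
  left_inv q := by simp
  right_inv q := by simp

/-- The sesquilinear form `∫ A f ḡ` in terms of the Fourier coefficients of `A`, `f`, `g`. -/
theorem hasSum_integral_mul_seriesL2 {n : ℕ} {A : Torus n → ℝ} {α₁ : ℝ}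
    (hA : AEMeasurable A (torusMeasure n)) (hb : ∀ y, ‖A y‖ ≤ α₁)
    (hsum : Summable fun k => ‖fourierCoeffTorus A k‖) {c c' : (Fin n → ℤ) → ℂ}
    (hc : Summable fun k => ‖c k‖ ^ 2) (hc' : Summable fun k => ‖c' k‖ ^ 2) :
    HasSum (fun q : (Fin n → ℤ) × (Fin n → ℤ) =>
      fourierCoeffTorus A q.1 * c q.2 * conj (c' (q.2 + q.1)))
      (∫ y, (A y : ℂ) * seriesL2 c y * conj (seriesL2 c' y) ∂(torusMeasure n)) := by
  obtain ⟨M, hM⟩ := exists_multiplier hA hb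
  rw [← hM]
  -- Absolute summability over pairs, from Young's inequality, permits iterated summation below.
  have hS : Summable fun q : (Fin n → ℤ) × (Fin n → ℤ) =>
      fourierCoeffTorus A q.1 * c q.2 * conj (c' (q.2 + q.1)) := by
    refine Summable.of_norm ?_
    simpa using (summable_convolution_and_tsum_le (fun k => norm_nonneg _)
      (fun k => norm_nonneg _) (fun k => norm_nonneg _) hsum hc hc').1
  set f : (Fin n → ℤ) × (Fin n → ℤ) → ℂ := fun r =>
    fourierCoeffTorus A (r.1 - r.2) * c r.2 * conj (c' r.1) with hf
  have hfe : f ∘ shearEquiv (Fin n → ℤ) = fun q =>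
      fourierCoeffTorus A q.1 * c q.2 * conj (c' (q.2 + q.1)) := by
    ext q; simp [hf, shearEquiv]
  rw [← hfe] at hS ⊢
  rw [Equiv.hasSum_iff]
  rw [Equiv.summable_iff] at hS
  -- The inner sum expands the first series through the continuous operator M; `h3` then expands the
  -- second.
  have h1 : ∀ k, HasSum (fun l => f (k, l)) (conj (c' k) * ⟪modeLp k, M (seriesL2 c)⟫_ℂ) := by
    intro k
    have h := (((hasSum_seriesL2 hc).mapL M).mapL (innerSL ℂ (modeLp k))).mul_left (conj (c' k))
    refine h.congr_fun fun l => ?_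
    change f (k, l) = conj (c' k) * ⟪modeLp k, M (c l • modeLp l)⟫_ℂ
    rw [map_smul, inner_smul_right, hM, integral_mul_mode]
    simp only [hf]
    ring
  have h2 := hS.hasSum.prod_fiberwise h1
  have h3 : HasSum (fun k => conj (c' k) * ⟪modeLp k, M (seriesL2 c)⟫_ℂ)
      ⟪seriesL2 c', M (seriesL2 c)⟫_ℂ := by
    have h := (hasSum_seriesL2 hc').mapL (innerSL ℂ (M (seriesL2 c)))
    have h' := h.mapL (Complex.conjCLE : ℂ →L[ℝ] ℂ)
    simpa using h'
  rw [← h2.unique h3]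
  exact hS.hasSum

/-! ### The energy form in Fourier variables. -/

section Energy

variable {d n : ℕ} {P : Matrix (Fin d) (Fin n) ℝ} {A : Torus n → ℝ} {α₀ α₁ : ℝ}

/-- `U` has a square summable gradient. -/
def HasL2Grad (P : Matrix (Fin d) (Fin n) ℝ) (U : (Fin n → ℤ) → ℂ) : Prop :=
  Summable fun k => (‖projFreq P k‖ * ‖U k‖) ^ 2

/-- The `L²` norm of the gradient. -/
def gradNorm (P : Matrix (Fin d) (Fin n) ℝ) (U : (Fin n → ℤ) → ℂ) : ℝ :=
  √(∑' k, (‖projFreq P k‖ * ‖U k‖) ^ 2)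

theorem gradNorm_sq (P : Matrix (Fin d) (Fin n) ℝ) (U : (Fin n → ℤ) → ℂ) :
    gradNorm P U ^ 2 = ∑' k, (‖projFreq P k‖ * ‖U k‖) ^ 2 :=
  Real.sq_sqrt (tsum_nonneg fun _ => sq_nonneg _)

theorem sum_norm_sq_projGradCoeff (U : (Fin n → ℤ) → ℂ) (k : Fin n → ℤ) :
    ∑ j, ‖projGradCoeff P U j k‖ ^ 2 = (‖projFreq P k‖ * ‖U k‖) ^ 2 := by
  rw [mul_pow, EuclideanSpace.norm_sq_eq, Finset.sum_mul]
  refine Finset.sum_congr rfl fun j _ => ?_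
  simp [projGradCoeff, mul_pow]

theorem HasL2Grad.summable_projGradCoeff {U : (Fin n → ℤ) → ℂ} (hU : HasL2Grad P U) (j : Fin d) :
    Summable fun k => ‖projGradCoeff P U j k‖ ^ 2 := by
  refine Summable.of_nonneg_of_le (fun _ => by positivity) (fun k => ?_) hU
  rw [← sum_norm_sq_projGradCoeff]
  exact Finset.single_le_sum (f := fun j => ‖projGradCoeff P U j k‖ ^ 2)
    (fun _ _ => by positivity) (Finset.mem_univ j)

theorem HasL2Grad.sum_norm_sq_seriesL2 {U : (Fin n → ℤ) → ℂ} (hU : HasL2Grad P U) :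
    ∑ j, ‖seriesL2 (projGradCoeff P U j)‖ ^ 2 = gradNorm P U ^ 2 := by
  rw [gradNorm_sq]
  simp only [norm_sq_seriesL2 (hU.summable_projGradCoeff _), ← sum_norm_sq_projGradCoeff]
  rw [Summable.tsum_finsetSum fun j _ => hU.summable_projGradCoeff j]

/-- Coercivity of the energy form. -/
theorem HasL2Grad.le_energyForm (hA : AEMeasurable A (torusMeasure n))
    (hAb : ∀ y, α₀ ≤ A y ∧ A y ≤ α₁) {U : (Fin n → ℤ) → ℂ} (hU : HasL2Grad P U) :
    α₀ * gradNorm P U ^ 2 ≤ (energyForm P A U U).re := by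
  rw [← hU.sum_norm_sq_seriesL2, Finset.mul_sum, energyForm, Complex.re_sum]
  exact Finset.sum_le_sum fun j _ => le_integral_mul_norm_sq hA hAb _

/-- Besides the commutator bound, this expansion supplies the linearity of the form used for
uniqueness. -/
theorem HasL2Grad.hasSum_energyForm (hA : AEMeasurable A (torusMeasure n))
    (hb : ∀ y, ‖A y‖ ≤ α₁) (hsum : Summable fun k => ‖fourierCoeffTorus A k‖)
    {U V : (Fin n → ℤ) → ℂ} (hU : HasL2Grad P U) (hV : HasL2Grad P V) :
    HasSum (fun q : (Fin n → ℤ) × (Fin n → ℤ) => fourierCoeffTorus A q.1 *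
      (⟪projFreq P q.2, projFreq P (q.2 + q.1)⟫_ℝ : ℂ) * U q.2 * conj (V (q.2 + q.1)))
      (energyForm P A U V) := by
  have h := hasSum_sum fun j (_ : j ∈ Finset.univ) => hasSum_integral_mul_seriesL2 hA hb hsum
    (hU.summable_projGradCoeff j) (hV.summable_projGradCoeff j)
  refine h.congr_fun fun q => ?_
  rw [PiLp.inner_apply, Complex.ofReal_sum, Finset.mul_sum, Finset.sum_mul, Finset.sum_mul]
  refine Finset.sum_congr rfl fun j _ => ?_
  simp only [projGradCoeff, map_mul, Complex.conj_I, Complex.conj_ofReal, RCLike.inner_apply,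
    conj_trivial, Complex.ofReal_mul]
  linear_combination (fourierCoeffTorus A q.1 * (projFreq P q.2 j : ℂ) * U q.2 *
    (projFreq P (q.2 + q.1) j : ℂ) * conj (V (q.2 + q.1))) * Complex.I_mul_I

end Energy

/-! ### Lattice sums and the derivatives of A. -/

/-- The integer vectors form a lattice of rank n, over which |k|^r is summable; 1 + |k| ≥ |k| and r
≤ 0 give the comparison. -/
theorem summable_one_add_freqNorm_rpow {n : ℕ} {r : ℝ} (hr : r < -n) :
    Summable fun k : Fin n → ℤ => (1 + freqNorm k) ^ r := by
  set b := (EuclideanSpace.basisFun (Fin n) ℝ).toBasis with hb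
  let v : (Fin n → ℤ) → EuclideanSpace ℝ (Fin n) := fun k => WithLp.toLp 2 (fun i => (k i : ℝ))
  have hmem : ∀ k, v k ∈ Submodule.span ℤ (Set.range b) := by
    intro k
    have : v k = ∑ i, k i • b i := by
      ext j
      simp [hb, v, Finset.sum_apply, Pi.single_apply]
    rw [this]
    exact Submodule.sum_mem _ fun i _ =>
      Submodule.smul_mem _ _ (Submodule.subset_span (Set.mem_range_self i))
  have hrank : Module.finrank ℤ (Submodule.span ℤ (Set.range b)) = n := by
    rw [ZLattice.rank ℝ, finrank_euclideanSpace_fin]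
  have h := ZLattice.summable_norm_rpow (Submodule.span ℤ (Set.range b)) r (by rwa [hrank])
  let g : (Fin n → ℤ) → Submodule.span ℤ (Set.range b) := fun k => ⟨v k, hmem k⟩
  have hinj : Function.Injective g := by
    intro k l hkl
    have h1 : v k = v l := congrArg Subtype.val hkl
    ext i
    have h3 : (k i : ℝ) = l i := congrFun (congrArg WithLp.ofLp h1) i
    exact_mod_cast h3
  have h2 : Summable fun k : Fin n → ℤ => freqNorm k ^ r :=
    (h.comp_injective hinj).congr fun k => rfl
  -- The comparison fails at the origin, where `0 ^ r = 0` for r < 0.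
  refine Summable.of_norm_bounded_eventually h2 ?_
  filter_upwards [(Set.finite_singleton (0 : Fin n → ℤ)).compl_mem_cofinite] with k hk
  have hk0 : 0 < freqNorm k := by
    refine norm_pos_iff.2 fun h0 => hk ?_
    have h3 := congrArg WithLp.ofLp h0
    refine Set.mem_singleton_iff.2 (funext fun i => ?_)
    have h4 : (k i : ℝ) = 0 := congrFun h3 i
    exact_mod_cast h4
  have hr0 : r ≤ 0 := by have : (0 : ℝ) ≤ n := n.cast_nonneg; linarith
  rw [Real.norm_of_nonneg (by positivity)]
  exact Real.rpow_le_rpow_of_nonpos hk0 (by linarith) hr0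

theorem freqNorm_nonneg {n : ℕ} (k : Fin n → ℤ) : 0 ≤ freqNorm k := norm_nonneg _

section

variable {d n : ℕ} {P : Matrix (Fin d) (Fin n) ℝ}

/-- `|P k| ≤ C_λ |k|`. -/
theorem norm_projFreq_le (P : Matrix (Fin d) (Fin n) ℝ) (k : Fin n → ℤ) :
    ‖projFreq P k‖ ≤ lambdaConst P * freqNorm k := by
  set x : Fin n → ℝ := fun i => (k i : ℝ) with hx
  set lam := sSup (spectrum ℝ (P.transpose * P)) with hlam
  have hH : (P.transpose * P).IsHermitian := by
    simpa using Matrix.isHermitian_conjTranspose_mul_self P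
  have hbdd : BddAbove (spectrum ℝ (P.transpose * P)) := by
    rw [hH.spectrum_real_eq_range_eigenvalues]
    exact (Set.finite_range _).bddAbove
  -- The spectrum of lam − PᵀP is lam minus that of PᵀP, hence nonnegative; the quadratic form at k
  -- is then lam |k|² − |Pk|².
  have hpsd : (algebraMap ℝ (Matrix (Fin n) (Fin n) ℝ) lam - P.transpose * P).PosSemidef := by
    rw [Matrix.posSemidef_iff_isHermitian_and_spectrum_nonneg]
    refine ⟨?_, ?_⟩
    · refine Matrix.IsHermitian.sub ?_ hH
      rw [Algebra.algebraMap_eq_smul_one]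
      ext i j
      simp [Matrix.one_apply, eq_comm]
    · rw [← spectrum.singleton_sub_eq]
      rintro _ ⟨_, rfl, μ, hμ, rfl⟩
      exact sub_nonneg.2 (le_csSup hbdd hμ)
  have h := hpsd.dotProduct_mulVec_nonneg x
  have h1 : ‖projFreq P k‖ ^ 2 = x ⬝ᵥ (P.transpose * P).mulVec x := by
    rw [EuclideanSpace.norm_sq_eq, ← Matrix.mulVec_mulVec, Matrix.dotProduct_mulVec,
      Matrix.vecMul_transpose]
    simp [projFreq, dotProduct, sq, hx]
  have h2 : freqNorm k ^ 2 = x ⬝ᵥ x := by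
    rw [freqNorm, EuclideanSpace.norm_sq_eq]
    simp [dotProduct, sq, hx]
  have h3 : ‖projFreq P k‖ ^ 2 ≤ lam * freqNorm k ^ 2 := by
    rw [h1, h2]
    rw [Matrix.sub_mulVec, dotProduct_sub, Algebra.algebraMap_eq_smul_one, Matrix.smul_mulVec,
      Matrix.one_mulVec, dotProduct_smul] at h
    simpa using h
  calc ‖projFreq P k‖ = √(‖projFreq P k‖ ^ 2) := (Real.sqrt_sq (norm_nonneg _)).symm
    _ ≤ √(lam * freqNorm k ^ 2) := Real.sqrt_le_sqrt h3
    _ = lambdaConst P * freqNorm k := by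
      rw [Real.sqrt_mul' _ (sq_nonneg _), Real.sqrt_sq (freqNorm_nonneg k), lambdaConst]

theorem projFreq_add (P : Matrix (Fin d) (Fin n) ℝ) (k l : Fin n → ℤ) :
    projFreq P (k + l) = projFreq P k + projFreq P l := by
  have : (fun i => ((k + l) i : ℝ)) = (fun i => (k i : ℝ)) + fun i => (l i : ℝ) := by
    ext; simp
  rw [projFreq, this, Matrix.mulVec_add]
  rfl

theorem projFreq_zero (P : Matrix (Fin d) (Fin n) ℝ) : projFreq P 0 = 0 := by
  have h := projFreq_add P 0 0
  simpa using h

theorem projFreq_ne_zero (hP : IsProjectionMatrix P) {k : Fin n → ℤ} (hk : k ≠ 0) :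
    projFreq P k ≠ 0 := by
  intro h
  refine hk ?_
  have h0 := congrArg WithLp.ofLp h
  have hlin := Fintype.linearIndependent_iff.1 hP (fun j => (k j : ℚ)) (by
    ext i
    have := congrFun h0 i
    simp only [projFreq, Matrix.mulVec, dotProduct] at this
    simp only [Finset.sum_apply, Pi.smul_apply, Matrix.col_apply, Rat.smul_def, Rat.cast_intCast]
    simpa [mul_comm] using this)
  ext j
  exact_mod_cast hlin j

theorem norm_projFreq_pos (hP : IsProjectionMatrix P) {k : Fin n → ℤ} (hk : k ≠ 0) :
    0 < ‖projFreq P k‖ := norm_pos_iff.2 (projFreq_ne_zero hP hk)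

/-- The derivatives of order `j` of a function with Fourier coefficients of size
`C_A (1 + |k|)^{-N}` have an absolutely convergent Fourier series. -/
theorem summable_and_tsum_mul_norm_projFreq_pow_le {a : (Fin n → ℤ) → ℂ} {CA N : ℝ} {j : ℕ}
    (hCA : 0 ≤ CA) (hN : (n : ℝ) + j < N) (ha : ∀ k, ‖a k‖ ≤ CA * (1 + freqNorm k) ^ (-N)) :
    (Summable fun k => ‖a k‖ * ‖projFreq P k‖ ^ j) ∧
      ∑' k, ‖a k‖ * ‖projFreq P k‖ ^ j ≤ derivConst P CA N j := by
  have hle : ∀ k, ‖a k‖ * ‖projFreq P k‖ ^ j ≤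
      lambdaConst P ^ j * CA * (1 + freqNorm k) ^ ((j : ℝ) - N) := by
    intro k
    have hk := freqNorm_nonneg k
    have hl : 0 ≤ lambdaConst P := Real.sqrt_nonneg _
    calc ‖a k‖ * ‖projFreq P k‖ ^ j
        ≤ (CA * (1 + freqNorm k) ^ (-N)) * (lambdaConst P * (1 + freqNorm k)) ^ j := by
          refine mul_le_mul (ha k) (pow_le_pow_left₀ (norm_nonneg _) ?_ _) (by positivity)
            (by positivity)
          exact (norm_projFreq_le P k).trans (mul_le_mul_of_nonneg_left (by linarith) hl)
      _ = _ := by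
          rw [sub_eq_add_neg, Real.rpow_add (by positivity), Real.rpow_natCast, mul_pow]
          ring
  have hs := (summable_one_add_freqNorm_rpow (n := n) (r := (j : ℝ) - N) (by linarith)).mul_left
    (lambdaConst P ^ j * CA)
  have hS := Summable.of_nonneg_of_le (fun k => by positivity) hle hs
  refine ⟨hS, ?_⟩
  rw [derivConst, ← tsum_mul_left]
  exact hS.tsum_le_tsum hle hs

theorem derivConst_nonneg {CA N : ℝ} (hCA : 0 ≤ CA) (j : ℕ) : 0 ≤ derivConst P CA N j := by
  refine mul_nonneg (mul_nonneg (pow_nonneg (Real.sqrt_nonneg _) _) hCA) (tsum_nonneg fun k => ?_)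
  have := freqNorm_nonneg k
  positivity

end

/-! ### Truncated weights, commutator and regularity estimate. -/

/-- The difference of truncated powers is controlled by the binomial expansion. -/
theorem abs_min_pow_sub_min_pow_le {a b t : ℝ} (R : ℝ) (ha : 0 ≤ a) (hb : 0 ≤ b) (hR : 0 ≤ R)
    (hab : |a - b| ≤ t) (M : ℕ) :
    |min a R ^ M - min b R ^ M| ≤
      ∑ j ∈ Finset.range M, (M.choose j : ℝ) * t ^ (M - j) * b ^ j := by
  -- Truncation is 1-Lipschitz, so the larger base is the smaller one plus some e ≤ t, and the
  -- smaller is at most b in either order. The leading binomial term cancels.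
  have key : ∀ x e : ℝ, 0 ≤ x → 0 ≤ e → e ≤ t → x ≤ b → |(x + e) ^ M - x ^ M| ≤
      ∑ j ∈ Finset.range M, (M.choose j : ℝ) * t ^ (M - j) * b ^ j := by
    intro x e hx he het hxb
    rw [add_pow, Finset.sum_range_succ]
    simp only [Nat.sub_self, pow_zero, Nat.choose_self, Nat.cast_one, mul_one, add_sub_cancel_right]
    rw [abs_of_nonneg (Finset.sum_nonneg fun j _ => by positivity)]
    refine Finset.sum_le_sum fun j _ => ?_
    calc x ^ j * e ^ (M - j) * (M.choose j : ℝ) ≤ b ^ j * t ^ (M - j) * (M.choose j : ℝ) := by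
          gcongr
      _ = _ := by ring
  have hmin : |min a R - min b R| ≤ t := by
    refine le_trans ?_ hab
    simpa using abs_min_sub_min_le_max a R b R
  obtain ⟨h1, h2⟩ := abs_le.1 hmin
  rcases le_total (min b R) (min a R) with h | h
  · have := key (min b R) (min a R - min b R) (le_min hb hR) (by linarith) h2 (min_le_left _ _)
    rwa [add_sub_cancel] at this
  · have := key (min a R) (min b R - min a R) (le_min ha hR) (by linarith) (by linarith)
      (h.trans (min_le_left _ _))
    rwa [add_sub_cancel, abs_sub_comm] at this

variable {d n : ℕ} {P : Matrix (Fin d) (Fin n) ℝ} {A : Torus n → ℝ} {α₀ α₁ : ℝ}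

/-- Multiplication of the Fourier coefficients by a bounded weight preserves square summable
gradients. -/
theorem HasL2Grad.mul_bounded {U : (Fin n → ℤ) → ℂ} (hU : HasL2Grad P U) {w : (Fin n → ℤ) → ℝ}
    {B : ℝ} (hw : ∀ k, |w k| ≤ B) : HasL2Grad P fun k => (w k : ℂ) * U k := by
  refine Summable.of_nonneg_of_le (fun _ => by positivity) (fun k => ?_) (hU.mul_left (B ^ 2))
  rw [← mul_pow]
  refine pow_le_pow_left₀ (by positivity) ?_ 2
  rw [norm_mul, Complex.norm_real, Real.norm_eq_abs, mul_left_comm]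
  exact mul_le_mul_of_nonneg_right (hw k) (by positivity)

/-- The coefficients weighted by `|P k|^j` are square summable. -/
def HasSob (P : Matrix (Fin d) (Fin n) ℝ) (j : ℕ) (U : (Fin n → ℤ) → ℂ) : Prop :=
  Summable fun k => (‖projFreq P k‖ ^ j * ‖U k‖) ^ 2

/-- The `ℓ²` norm of the coefficients weighted by `|P k|^j`. -/
def sobNorm (P : Matrix (Fin d) (Fin n) ℝ) (j : ℕ) (U : (Fin n → ℤ) → ℂ) : ℝ :=
  √(∑' k, (‖projFreq P k‖ ^ j * ‖U k‖) ^ 2)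

theorem sobNorm_nonneg (P : Matrix (Fin d) (Fin n) ℝ) (j : ℕ) (U : (Fin n → ℤ) → ℂ) :
    0 ≤ sobNorm P j U := Real.sqrt_nonneg _

theorem hasSob_one {U : (Fin n → ℤ) → ℂ} : HasSob P 1 U ↔ HasL2Grad P U := by
  simp [HasSob, HasL2Grad]

theorem sobNorm_one (U : (Fin n → ℤ) → ℂ) : sobNorm P 1 U = gradNorm P U := by
  simp [sobNorm, gradNorm]

/-- The commutator of the energy form with a Fourier multiplier `w` whose increments are dominated
by sums of products. -/
theorem norm_energyForm_commutator_le (hA : AEMeasurable A (torusMeasure n))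
    (hb : ∀ y, ‖A y‖ ≤ α₁) (hsum : Summable fun k => ‖fourierCoeffTorus A k‖)
    {U V : (Fin n → ℤ) → ℂ} (hU : HasL2Grad P U) (hV : HasL2Grad P V)
    {w : (Fin n → ℤ) → ℝ} {B : ℝ} (hwB : ∀ k, |w k| ≤ B) (s : Finset ℕ)
    {b : ℕ → (Fin n → ℤ) → ℝ} (hb0 : ∀ j k, 0 ≤ b j k) (hbs : ∀ j ∈ s, Summable (b j))
    (hUs : ∀ j ∈ s, HasSob P (j + 1) U)
    (hw : ∀ p l, ‖fourierCoeffTorus A p‖ * |w (l + p) - w l| ≤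
      ∑ j ∈ s, b j p * ‖projFreq P l‖ ^ j) :
    ‖energyForm P A U (fun k => (w k : ℂ) * V k) - energyForm P A (fun k => (w k : ℂ) * U k) V‖ ≤
      (∑ j ∈ s, (∑' k, b j k) * sobNorm P (j + 1) U) * gradNorm P V := by
  have h1 := hU.hasSum_energyForm hA hb hsum (hV.mul_bounded hwB)
  have h2 := (hU.mul_bounded hwB).hasSum_energyForm hA hb hsum hV
  have h3 := h1.sub h2
  -- Of the j + 1 powers of |Pl|, j come from the increment of w and one from the gradient of U.
  have hY := fun j hj => summable_convolution_and_tsum_le (hb0 j)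
    (x := fun l => ‖projFreq P l‖ ^ (j + 1) * ‖U l‖) (y := fun l => ‖projFreq P l‖ * ‖V l‖)
    (fun l => by positivity) (fun l => by positivity) (hbs j hj) (hUs j hj) hV
  have hS := summable_sum fun j hj => (hY j hj).1
  rw [← h3.tsum_eq]
  refine (tsum_of_norm_bounded hS.hasSum fun q => ?_).trans ?_
  · have e : fourierCoeffTorus A q.1 *
          (⟪projFreq P q.2, projFreq P (q.2 + q.1)⟫_ℝ : ℂ) * U q.2 *
            conj ((w (q.2 + q.1) : ℂ) * V (q.2 + q.1)) -
        fourierCoeffTorus A q.1 *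
          (⟪projFreq P q.2, projFreq P (q.2 + q.1)⟫_ℝ : ℂ) * ((w q.2 : ℂ) * U q.2) *
            conj (V (q.2 + q.1)) =
        fourierCoeffTorus A q.1 * ((w (q.2 + q.1) - w q.2 : ℝ) : ℂ) *
          ((⟪projFreq P q.2, projFreq P (q.2 + q.1)⟫_ℝ : ℝ) : ℂ) * (U q.2 *
            conj (V (q.2 + q.1))) := by
      rw [map_mul, Complex.conj_ofReal]; push_cast; ring
    rw [e]
    simp only [norm_mul, Complex.norm_real, RCLike.norm_conj]
    calc ‖fourierCoeffTorus A q.1‖ * ‖w (q.2 + q.1) - w q.2‖ *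
          ‖⟪projFreq P q.2, projFreq P (q.2 + q.1)⟫_ℝ‖ * (‖U q.2‖ * ‖V (q.2 + q.1)‖)
        ≤ (∑ j ∈ s, b j q.1 * ‖projFreq P q.2‖ ^ j) *
          (‖projFreq P q.2‖ * ‖projFreq P (q.2 + q.1)‖) * (‖U q.2‖ * ‖V (q.2 + q.1)‖) := by
          refine mul_le_mul_of_nonneg_right ?_ (by positivity)
          exact mul_le_mul (hw _ _) (norm_inner_le_norm _ _) (norm_nonneg _)
            (Finset.sum_nonneg fun j _ => mul_nonneg (hb0 _ _) (by positivity))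
      _ = _ := by
          rw [Finset.sum_mul, Finset.sum_mul]
          exact Finset.sum_congr rfl fun j _ => by ring
  · rw [Summable.tsum_finsetSum fun j hj => (hY j hj).1, Finset.sum_mul]
    exact Finset.sum_le_sum fun j hj => (hY j hj).2

/-- The truncated power `min(|P k|, R)^M`. -/
def truncWeight (P : Matrix (Fin d) (Fin n) ℝ) (R : ℝ) (M : ℕ) (k : Fin n → ℤ) : ℝ :=
  min ‖projFreq P k‖ R ^ M

theorem truncWeight_nonneg {R : ℝ} (hR : 0 ≤ R) (M : ℕ) (k : Fin n → ℤ) :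
    0 ≤ truncWeight P R M k := pow_nonneg (le_min (norm_nonneg _) hR) _

theorem abs_truncWeight_le {R : ℝ} (hR : 0 ≤ R) (M : ℕ) (k : Fin n → ℤ) :
    |truncWeight P R M k| ≤ R ^ M := by
  rw [abs_of_nonneg (truncWeight_nonneg hR M k)]
  exact pow_le_pow_left₀ (le_min (norm_nonneg _) hR) (min_le_right _ _) _

theorem truncWeight_le {R : ℝ} (hR : 0 ≤ R) (M : ℕ) (k : Fin n → ℤ) :
    truncWeight P R M k ≤ ‖projFreq P k‖ ^ M :=
  pow_le_pow_left₀ (le_min (norm_nonneg _) hR) (min_le_left _ _) _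

theorem abs_truncWeight_sub_le {R : ℝ} (hR : 0 ≤ R) (M : ℕ) (p l : Fin n → ℤ) :
    |truncWeight P R M (l + p) - truncWeight P R M l| ≤ ∑ j ∈ Finset.range M,
      (M.choose j : ℝ) * ‖projFreq P p‖ ^ (M - j) * ‖projFreq P l‖ ^ j := by
  refine abs_min_pow_sub_min_pow_le R (norm_nonneg _) (norm_nonneg _) hR ?_ M
  refine (abs_norm_sub_norm_le _ _).trans ?_
  rw [projFreq_add, add_sub_cancel_left]

/-- The energy estimate with a truncated weight. -/
theorem gradNorm_truncWeight_mul_le (hA : AEMeasurable A (torusMeasure n)) (hα₀ : 0 < α₀)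
    (hAb : ∀ y, α₀ ≤ A y ∧ A y ≤ α₁) {m : ℕ}
    (hsum : ∀ j ≤ m + 1, Summable fun k => ‖fourierCoeffTorus A k‖ * ‖projFreq P k‖ ^ j)
    {F U : (Fin n → ℤ) → ℂ} (hF : HasSob P m F) (hU : ∀ j ≤ m, HasSob P (j + 1) U)
    (heq : ∀ V, V 0 = 0 → HasL2Grad P V → energyForm P A U V = ∑' k, F k * conj (V k))
    (hU0 : U 0 = 0) {R : ℝ} (hR : 0 ≤ R) :
    gradNorm P (fun k => (truncWeight P R (m + 1) k : ℂ) * U k) ≤ α₀⁻¹ * (sobNorm P m F +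
      ∑ j ∈ Finset.range (m + 1), ((m + 1).choose j : ℝ) *
        (∑' k, ‖fourierCoeffTorus A k‖ * ‖projFreq P k‖ ^ (m + 1 - j)) * sobNorm P (j + 1) U) := by
  set w := truncWeight P R (m + 1) with hw
  -- The test function is wV = w²U. It is admissible because the truncated w is bounded.
  set V : (Fin n → ℤ) → ℂ := fun k => (w k : ℂ) * U k with hV
  have hwB := abs_truncWeight_le (P := P) hR (m + 1)
  have hUg : HasL2Grad P U := hasSob_one.1 (hU 0 m.zero_le)
  have hVg : HasL2Grad P V := hUg.mul_bounded hwB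
  have hVw : HasL2Grad P fun k => (w k : ℂ) * V k := hVg.mul_bounded hwB
  have hb : ∀ y, ‖A y‖ ≤ α₁ := fun y => by
    rw [Real.norm_of_nonneg (hα₀.le.trans (hAb y).1)]; exact (hAb y).2
  have hcomm := norm_energyForm_commutator_le hA hb (by simpa using hsum 0 (Nat.zero_le _)) hUg
    hVg hwB (Finset.range (m + 1))
    (b := fun j k => ((m + 1).choose j : ℝ) *
      (‖fourierCoeffTorus A k‖ * ‖projFreq P k‖ ^ (m + 1 - j)))
    (fun j k => by positivity) (fun j _ => (hsum _ (Nat.sub_le _ _)).mul_left _)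
    (fun j hj => hU j (Nat.lt_succ_iff.1 (Finset.mem_range.1 hj))) (fun p l => by
      refine (mul_le_mul_of_nonneg_left (abs_truncWeight_sub_le hR _ p l) (norm_nonneg _)).trans
        (le_of_eq ?_)
      rw [Finset.mul_sum]
      exact Finset.sum_congr rfl fun j _ => by ring)
  simp only [tsum_mul_left] at hcomm
  set E := ∑ j ∈ Finset.range (m + 1), ((m + 1).choose j : ℝ) *
        (∑' k, ‖fourierCoeffTorus A k‖ * ‖projFreq P k‖ ^ (m + 1 - j)) * sobNorm P (j + 1) U
  -- One factor w stays in V. The other is at most |Pk|^(m+1), of which m powers go to F and one to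
  -- V.
  have hpair : ‖energyForm P A U fun k => (w k : ℂ) * V k‖ ≤ sobNorm P m F * gradNorm P V := by
    rw [heq _ (by simp [hV, hU0]) hVw]
    have hcs := summable_mul_and_tsum_mul_le_sqrt (x := fun k => ‖projFreq P k‖ ^ m * ‖F k‖)
      (y := fun k => ‖projFreq P k‖ * ‖V k‖) (fun k => by positivity) (fun k => by positivity)
      hF hVg
    refine (tsum_of_norm_bounded hcs.1.hasSum fun k => ?_).trans hcs.2
    rw [norm_mul, RCLike.norm_conj, norm_mul, Complex.norm_real,
      Real.norm_of_nonneg (truncWeight_nonneg hR _ k)]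
    have := truncWeight_le (P := P) hR (m + 1) k
    calc ‖F k‖ * (w k * ‖V k‖) ≤ ‖F k‖ * (‖projFreq P k‖ ^ (m + 1) * ‖V k‖) := by gcongr
      _ = _ := by ring
  have hco := hVg.le_energyForm hA hAb
  have h4 : α₀ * gradNorm P V ^ 2 ≤ (sobNorm P m F + E) * gradNorm P V := by
    refine hco.trans ((Complex.re_le_norm _).trans ?_)
    have h5 : energyForm P A V V = energyForm P A U (fun k => (w k : ℂ) * V k) -
      (energyForm P A U (fun k => (w k : ℂ) * V k) - energyForm P A V V) := by ring
    rw [h5, add_mul]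
    exact (norm_sub_le _ _).trans (add_le_add hpair hcomm)
  have hg0 : 0 ≤ gradNorm P V := Real.sqrt_nonneg _
  rcases hg0.eq_or_lt with h0 | h0
  · rw [← h0]
    have : 0 ≤ E := Finset.sum_nonneg fun j _ =>
      mul_nonneg (mul_nonneg (Nat.cast_nonneg _) (tsum_nonneg fun _ => by positivity))
        (sobNorm_nonneg _ _ _)
    have := sobNorm_nonneg P m F
    positivity
  · rw [inv_mul_eq_div, le_div_iff₀ hα₀]
    nlinarith

/-- Interior regularity in the scale of projected Sobolev spaces: the solution gains two orders
over the right-hand side. -/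
theorem hasSob_add_two_and_sobNorm_le (hA : AEMeasurable A (torusMeasure n)) (hα₀ : 0 < α₀)
    (hAb : ∀ y, α₀ ≤ A y ∧ A y ≤ α₁) {m : ℕ}
    (hsum : ∀ j ≤ m + 1, Summable fun k => ‖fourierCoeffTorus A k‖ * ‖projFreq P k‖ ^ j)
    {F U : (Fin n → ℤ) → ℂ} (hF : HasSob P m F) (hU : ∀ j ≤ m, HasSob P (j + 1) U)
    (heq : ∀ V, V 0 = 0 → HasL2Grad P V → energyForm P A U V = ∑' k, F k * conj (V k))
    (hU0 : U 0 = 0) :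
    HasSob P (m + 2) U ∧ sobNorm P (m + 2) U ≤ α₀⁻¹ * (sobNorm P m F +
      ∑ j ∈ Finset.range (m + 1), ((m + 1).choose j : ℝ) *
        (∑' k, ‖fourierCoeffTorus A k‖ * ‖projFreq P k‖ ^ (m + 1 - j)) * sobNorm P (j + 1) U) := by
  have key := fun R hR => gradNorm_truncWeight_mul_le (R := R) hA hα₀ hAb hsum hF hU heq hU0 hR
  set C := α₀⁻¹ * (sobNorm P m F + ∑ j ∈ Finset.range (m + 1), ((m + 1).choose j : ℝ) *
        (∑' k, ‖fourierCoeffTorus A k‖ * ‖projFreq P k‖ ^ (m + 1 - j)) * sobNorm P (j + 1) U)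
  have hUg : HasL2Grad P U := hasSob_one.1 (hU 0 m.zero_le)
  have hC0 : 0 ≤ C := (Real.sqrt_nonneg _).trans (key 0 le_rfl)
  have hfin : ∀ s : Finset (Fin n → ℤ),
      ∑ k ∈ s, (‖projFreq P k‖ ^ (m + 2) * ‖U k‖) ^ 2 ≤ C ^ 2 := by
    intro s
    -- Any R above all |Pk| with k in s works: the truncation is inactive on s, and C does not
    -- depend on R.
    set R := ∑ k ∈ s, ‖projFreq P k‖
    have hR : 0 ≤ R := Finset.sum_nonneg fun _ _ => norm_nonneg _
    have hg := pow_le_pow_left₀ (Real.sqrt_nonneg _) (key R hR) 2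
    have hVg := hUg.mul_bounded (abs_truncWeight_le (P := P) hR (m + 1))
    change gradNorm P _ ^ 2 ≤ _ at hg
    rw [gradNorm_sq] at hg
    refine le_trans ?_ hg
    refine le_trans (le_of_eq (Finset.sum_congr rfl fun k hk => ?_))
      (hVg.sum_le_tsum s fun k _ => by positivity)
    have hkR : ‖projFreq P k‖ ≤ R :=
      Finset.single_le_sum (f := fun k => ‖projFreq P k‖) (fun _ _ => norm_nonneg _) hk
    simp only [truncWeight, min_eq_left hkR, norm_mul, Complex.norm_real, norm_pow, norm_norm]
    ring
  refine ⟨summable_of_sum_le (fun k => by positivity) hfin, ?_⟩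
  refine Real.sqrt_le_iff.2 ⟨hC0, ?_⟩
  exact Real.tsum_le_of_sum_le (fun k => by positivity) hfin

/-! ### Existence, first-order bound and uniqueness. -/

/-- The square summable sequences indexed by the nonzero frequencies. -/
abbrev FreqL2 (n : ℕ) : Type := lp (fun _ : {k : Fin n → ℤ // k ≠ 0} => ℂ) 2

/-- The normalized gradients of the modes, as vector fields in `L²`. -/
def gradMode (P : Matrix (Fin d) (Fin n) ℝ) (k : {k : Fin n → ℤ // k ≠ 0}) :
    PiLp 2 (fun _ : Fin d => Lp ℂ 2 (torusMeasure n)) :=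
  WithLp.toLp 2 fun j => (Complex.I * (projFreq P k j : ℂ) / (‖projFreq P k‖ : ℂ)) • modeLp k.1

theorem orthonormal_gradMode (hP : IsProjectionMatrix P) : Orthonormal ℂ (gradMode P) := by
  rw [orthonormal_iff_ite]
  intro k l
  simp only [gradMode, PiLp.inner_apply, inner_smul_left, inner_smul_right,
    orthonormal_iff_ite.1 (orthonormal_modeLp n), Subtype.coe_inj]
  split_ifs with h
  · subst h
    have hpos := norm_projFreq_pos hP k.2
    have h1 : ∀ j, Complex.I * (projFreq P k j : ℂ) / (‖projFreq P k‖ : ℂ) *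
        (conj (Complex.I * (projFreq P k j : ℂ) / (‖projFreq P k‖ : ℂ)) * 1) =
        ((projFreq P k j ^ 2 / ‖projFreq P k‖ ^ 2 : ℝ) : ℂ) := by
      intro j
      rw [mul_one, Complex.mul_conj, Complex.normSq_eq_norm_sq]
      simp [div_pow]
    simp only [h1]
    rw [← Complex.ofReal_sum, ← Finset.sum_div, ← Complex.ofReal_one]
    congr 1
    rw [div_eq_one_iff_eq (by positivity), EuclideanSpace.norm_sq_eq]
    simp
  · simp

/-- The Fourier coefficients of the zero-mean function whose gradient has coefficients `G`. -/
def ofGradCoeff (P : Matrix (Fin d) (Fin n) ℝ) (G : {k : Fin n → ℤ // k ≠ 0} → ℂ)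
    (k : Fin n → ℤ) : ℂ :=
  if h : k ≠ 0 then G ⟨k, h⟩ / (‖projFreq P k‖ : ℂ) else 0

theorem tsum_eq_tsum_ne_zero {E : Type*} [AddCommMonoid E] [TopologicalSpace E] {n : ℕ}
    {f : (Fin n → ℤ) → E} (h0 : f 0 = 0) :
    ∑' k, f k = ∑' k : {k : Fin n → ℤ // k ≠ 0}, f k := by
  refine (tsum_subtype_eq_of_support_subset (s := {k | k ≠ 0}) fun k hk => ?_).symm
  rintro rfl
  exact hk h0

theorem summable_iff_summable_ne_zero {E : Type*} [AddCommMonoid E] [TopologicalSpace E] {n : ℕ}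
    {f : (Fin n → ℤ) → E} (h0 : f 0 = 0) :
    Summable f ↔ Summable fun k : {k : Fin n → ℤ // k ≠ 0} => f k := by
  refine (Subtype.val_injective.summable_iff fun k hk => ?_).symm
  have hk0 : k = 0 := by simpa using hk
  rw [hk0, h0]

theorem hasL2Grad_ofGradCoeff (hP : IsProjectionMatrix P) (G : FreqL2 n) :
    HasL2Grad P (ofGradCoeff P G) := by
  rw [HasL2Grad, summable_iff_summable_ne_zero (by simp [projFreq_zero])]
  have h := (memℓp_gen_iff (p := 2) (by norm_num)).1 (lp.memℓp G)
  refine h.congr fun k => ?_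
  have hpos := norm_projFreq_pos hP k.2
  simp only [ofGradCoeff, k.2, ne_eq, not_false_eq_true, dite_true, norm_div, Complex.norm_real,
    norm_norm]
  rw [mul_div_cancel₀ _ hpos.ne']
  norm_num

/-- The components of the isometry from gradient coefficients to vector fields. -/
def gradComponent (hP : IsProjectionMatrix P) (j : Fin d) :
    FreqL2 n →L[ℂ] Lp ℂ 2 (torusMeasure n) :=
  (PiLp.proj 2 (fun _ : Fin d => Lp ℂ 2 (torusMeasure n)) j).comp
    (orthonormal_gradMode hP).orthogonalFamily.linearIsometry.toContinuousLinearMap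

theorem sum_norm_sq_gradComponent (hP : IsProjectionMatrix P) (G : FreqL2 n) :
    ∑ j, ‖gradComponent hP j G‖ ^ 2 = ‖G‖ ^ 2 := by
  rw [← (orthonormal_gradMode hP).orthogonalFamily.linearIsometry.norm_map G,
    PiLp.norm_sq_eq_of_L2]
  rfl

/-- Identifies the abstract isometry with P∇U, so that the Lax–Milgram operator represents
`energyForm`. -/
theorem gradComponent_apply (hP : IsProjectionMatrix P) (j : Fin d) (G : FreqL2 n) :
    gradComponent hP j G = seriesL2 (projGradCoeff P (ofGradCoeff P G) j) := by
  have h := ((orthonormal_gradMode hP).orthogonalFamily.hasSum_linearIsometry G).mapL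
    (PiLp.proj (𝕜 := ℂ) 2 (fun _ : Fin d => Lp ℂ 2 (torusMeasure n)) j)
  rw [seriesL2, tsum_eq_tsum_ne_zero (by simp [projGradCoeff, projFreq_zero])]
  refine h.tsum_eq.symm.trans (tsum_congr fun k => ?_)
  simp only [ofGradCoeff, projGradCoeff, k.2, ne_eq, not_false_eq_true, dite_true]
  simp only [LinearIsometry.toSpanSingleton_apply, map_smul]
  change G k • ((Complex.I * (projFreq P k j : ℂ) / (‖projFreq P k‖ : ℂ)) • modeLp k.1) = _
  rw [smul_smul]
  congr 1
  ring

/-- Existence for the variational problem, by the Lax–Milgram argument. -/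
theorem exists_energyForm_eq (hP : IsProjectionMatrix P) (hA : AEMeasurable A (torusMeasure n))
    (hα₀ : 0 < α₀) (hAb : ∀ y, α₀ ≤ A y ∧ A y ≤ α₁) {F : (Fin n → ℤ) → ℂ} (hF0 : F 0 = 0)
    (hF : Summable fun k => (‖projFreq P k‖⁻¹ * ‖F k‖) ^ 2) :
    ∃ U : (Fin n → ℤ) → ℂ, U 0 = 0 ∧ HasL2Grad P U ∧
      ∀ V, V 0 = 0 → HasL2Grad P V → energyForm P A U V = ∑' k, F k * conj (V k) := by
  have hb : ∀ y, ‖A y‖ ≤ α₁ := fun y => by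
    rw [Real.norm_of_nonneg (hα₀.le.trans (hAb y).1)]; exact (hAb y).2
  obtain ⟨M, hM⟩ := exists_multiplier hA hb
  let L := gradComponent hP
  let T : FreqL2 n →L[ℂ] FreqL2 n := ∑ j, (L j).adjoint ∘L M ∘L L j
  have hT : ∀ G H : FreqL2 n, ⟪H, T G⟫_ℂ = ∑ j, ⟪L j H, M (L j G)⟫_ℂ := by
    intro G H
    simp only [T, sum_apply, inner_sum, ContinuousLinearMap.comp_apply,
      ContinuousLinearMap.adjoint_inner_right]
  have hTe : ∀ G H : FreqL2 n, ⟪H, T G⟫_ℂ =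
      energyForm P A (ofGradCoeff P G) (ofGradCoeff P H) := by
    intro G H
    simp only [hT, energyForm, hM, L, gradComponent_apply]
  have hunit : IsUnit T := by
    refine ContinuousLinearMap.isUnit_of_forall_le_norm_inner_map T (c := ⟨α₀, hα₀.le⟩) hα₀
      fun G => ?_
    rw [norm_inner_symm, hT]
    refine le_trans ?_ (Complex.re_le_norm _)
    rw [Complex.re_sum, ← sum_norm_sq_gradComponent hP, Finset.sum_mul]
    refine Finset.sum_le_sum fun j _ => ?_
    rw [hM, mul_comm]
    exact le_integral_mul_norm_sq hA hAb _
  -- The Riesz representative of F: its ℓ² pairing with |Pk| V_k is ⟨F, V⟩.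
  have hf : Memℓp (fun k : {k : Fin n → ℤ // k ≠ 0} => F k / (‖projFreq P k‖ : ℂ)) 2 := by
    refine (memℓp_gen_iff (by norm_num)).2 ?_
    rw [summable_iff_summable_ne_zero (by simp [hF0])] at hF
    refine hF.congr fun k => ?_
    rw [norm_div, Complex.norm_real, norm_norm, div_eq_inv_mul]
    norm_num
  obtain ⟨G, hG⟩ := (ContinuousLinearMap.isUnit_iff_bijective.1 hunit).2 ⟨_, hf⟩
  refine ⟨ofGradCoeff P G, by simp [ofGradCoeff], hasL2Grad_ofGradCoeff hP G, fun V hV0 hV => ?_⟩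
  have hh : Memℓp (fun k : {k : Fin n → ℤ // k ≠ 0} => (‖projFreq P k‖ : ℂ) * V k) 2 := by
    refine (memℓp_gen_iff (by norm_num)).2 ?_
    rw [HasL2Grad, summable_iff_summable_ne_zero (by simp [hV0])] at hV
    refine hV.congr fun k => ?_
    rw [norm_mul, Complex.norm_real, norm_norm]
    norm_num
  have hVe : ofGradCoeff P (⟨_, hh⟩ : FreqL2 n) = V := by
    ext k
    by_cases hk : k = 0
    · simp [ofGradCoeff, hk, hV0]
    · have : (‖projFreq P k‖ : ℂ) ≠ 0 := by exact_mod_cast (norm_projFreq_pos hP hk).ne'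
      simp only [ofGradCoeff, ne_eq, hk, not_false_eq_true, dite_true]
      exact mul_div_cancel_left₀ _ this
  have h1 := hTe G ⟨_, hh⟩
  rw [hVe, hG, lp.inner_eq_tsum] at h1
  rw [← h1, tsum_eq_tsum_ne_zero (by simp [hF0])]
  refine tsum_congr fun k => ?_
  have : (‖projFreq P k‖ : ℂ) ≠ 0 := by exact_mod_cast (norm_projFreq_pos hP k.2).ne'
  rw [RCLike.inner_apply, map_mul, Complex.conj_ofReal]
  change F k / (‖projFreq P k‖ : ℂ) * ((‖projFreq P k‖ : ℂ) * conj (V k)) = _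
  field_simp

/-- `‖U‖₁ ≤ α₀⁻¹ ‖F‖₋₁` for a solution of the variational problem. -/
theorem gradNorm_le_of_energyForm_eq (hP : IsProjectionMatrix P)
    (hA : AEMeasurable A (torusMeasure n)) (hα₀ : 0 < α₀) (hAb : ∀ y, α₀ ≤ A y ∧ A y ≤ α₁)
    {F U : (Fin n → ℤ) → ℂ} (hF0 : F 0 = 0)
    (hF : Summable fun k => (‖projFreq P k‖⁻¹ * ‖F k‖) ^ 2) (hU : HasL2Grad P U)
    (heq : energyForm P A U U = ∑' k, F k * conj (U k)) :
    gradNorm P U ≤ α₀⁻¹ * √(∑' k, (‖projFreq P k‖⁻¹ * ‖F k‖) ^ 2) := by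
  have hcs := summable_mul_and_tsum_mul_le_sqrt (x := fun k => ‖projFreq P k‖⁻¹ * ‖F k‖)
    (y := fun k => ‖projFreq P k‖ * ‖U k‖) (fun k => by positivity) (fun k => by positivity) hF hU
  have h1 : α₀ * gradNorm P U ^ 2 ≤
      √(∑' k, (‖projFreq P k‖⁻¹ * ‖F k‖) ^ 2) * gradNorm P U := by
    refine (hU.le_energyForm hA hAb).trans ((Complex.re_le_norm _).trans ?_)
    rw [heq]
    refine (tsum_of_norm_bounded hcs.1.hasSum fun k => ?_).trans hcs.2
    rw [norm_mul, RCLike.norm_conj]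
    by_cases hk : k = 0
    · simp [hk, hF0]
    · have := norm_projFreq_pos hP hk
      refine le_of_eq ?_
      field_simp
  have hg0 : 0 ≤ gradNorm P U := Real.sqrt_nonneg _
  rcases hg0.eq_or_lt with h0 | h0
  · rw [← h0]; positivity
  · rw [inv_mul_eq_div, le_div_iff₀ hα₀]
    nlinarith

/-- Uniqueness for the variational problem. -/
theorem eq_of_energyForm_eq (hP : IsProjectionMatrix P)
    (hA : AEMeasurable A (torusMeasure n)) (hα₀ : 0 < α₀) (hAb : ∀ y, α₀ ≤ A y ∧ A y ≤ α₁)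
    {U W : (Fin n → ℤ) → ℂ} (hU0 : U 0 = 0) (hW0 : W 0 = 0) (hU : HasL2Grad P U)
    (hW : HasL2Grad P W) (hsum : Summable fun k => ‖fourierCoeffTorus A k‖)
    (heq : ∀ V, V 0 = 0 → HasL2Grad P V → energyForm P A W V = energyForm P A U V) :
    W = U := by
  have hb : ∀ y, ‖A y‖ ≤ α₁ := fun y => by
    rw [Real.norm_of_nonneg (hα₀.le.trans (hAb y).1)]; exact (hAb y).2
  set D : (Fin n → ℤ) → ℂ := fun k => W k - U k with hD
  have hDg : HasL2Grad P D := by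
    refine Summable.of_nonneg_of_le (fun _ => by positivity) (fun k => ?_)
      ((hW.add hU).mul_left 2)
    have h1 : ‖D k‖ ≤ ‖W k‖ + ‖U k‖ := norm_sub_le _ _
    have h2 : ‖projFreq P k‖ * ‖D k‖ ≤ ‖projFreq P k‖ * ‖W k‖ + ‖projFreq P k‖ * ‖U k‖ := by
      rw [← mul_add]; gcongr
    have h3 : 0 ≤ ‖projFreq P k‖ * ‖D k‖ := by positivity
    nlinarith [sq_nonneg (‖projFreq P k‖ * ‖W k‖ - ‖projFreq P k‖ * ‖U k‖)]
  have hD0 : D 0 = 0 := by simp [hD, hU0, hW0]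
  -- Linearity in the first argument is read off the double series.
  have h1 := (hW.hasSum_energyForm hA hb hsum hDg).sub (hU.hasSum_energyForm hA hb hsum hDg)
  have h2 := hDg.hasSum_energyForm hA hb hsum hDg
  rw [heq D hD0 hDg, sub_self] at h1
  have h3 : energyForm P A D D = 0 := by
    refine h2.unique (h1.congr_fun fun q => ?_)
    simp only [hD]; ring
  have h4 := hDg.le_energyForm hA hAb
  rw [h3, gradNorm_sq, Complex.zero_re] at h4
  have h5 : ∑' k, (‖projFreq P k‖ * ‖D k‖) ^ 2 ≤ 0 := by
    by_contra h; push Not at h; nlinarith [mul_pos hα₀ h]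
  ext k
  by_cases hk : k = 0
  · simp [hk, hU0, hW0]
  · have h6 := (hDg.le_tsum k fun _ _ => by positivity).trans h5
    have h7 : ‖projFreq P k‖ * ‖D k‖ = 0 := pow_eq_zero_iff two_ne_zero |>.1
      (le_antisymm h6 (by positivity))
    rcases mul_eq_zero.1 h7 with h | h
    · exact absurd h (norm_projFreq_pos hP hk).ne'
    · exact sub_eq_zero.1 (norm_eq_zero.1 h)

/-! ### Interpolation between the norms of F. -/

section Interpolation

variable {F : (Fin n → ℤ) → ℂ}

/-- The coefficients weighted by `|P k|⁻¹` are square summable. -/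
def HasNegSob (P : Matrix (Fin d) (Fin n) ℝ) (U : (Fin n → ℤ) → ℂ) : Prop :=
  Summable fun k => (‖projFreq P k‖⁻¹ * ‖U k‖) ^ 2

/-- The `ℓ²` norm of the coefficients weighted by `|P k|⁻¹`. -/
def negSobNorm (P : Matrix (Fin d) (Fin n) ℝ) (U : (Fin n → ℤ) → ℂ) : ℝ :=
  √(∑' k, (‖projFreq P k‖⁻¹ * ‖U k‖) ^ 2)

theorem negSobNorm_nonneg (P : Matrix (Fin d) (Fin n) ℝ) (U : (Fin n → ℤ) → ℂ) :
    0 ≤ negSobNorm P U := Real.sqrt_nonneg _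

theorem sobNorm_sq (P : Matrix (Fin d) (Fin n) ℝ) (j : ℕ) (U : (Fin n → ℤ) → ℂ) :
    sobNorm P j U ^ 2 = ∑' k, (‖projFreq P k‖ ^ j * ‖U k‖) ^ 2 :=
  Real.sq_sqrt (tsum_nonneg fun _ => sq_nonneg _)

theorem negSobNorm_sq (P : Matrix (Fin d) (Fin n) ℝ) (U : (Fin n → ℤ) → ℂ) :
    negSobNorm P U ^ 2 = ∑' k, (‖projFreq P k‖⁻¹ * ‖U k‖) ^ 2 :=
  Real.sq_sqrt (tsum_nonneg fun _ => sq_nonneg _)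

/-- Homogeneous norms are not nested: order m dominates where |Pk| ≥ 1, order −1 where |Pk| ≤ 1. -/
theorem sq_weight_le (hP : IsProjectionMatrix P) (hF0 : F 0 = 0) {j m : ℕ} (hj : j ≤ m)
    (k : Fin n → ℤ) : (‖projFreq P k‖ ^ j * ‖F k‖) ^ 2 ≤
      (‖projFreq P k‖⁻¹ * ‖F k‖) ^ 2 + (‖projFreq P k‖ ^ m * ‖F k‖) ^ 2 := by
  by_cases hk : k = 0
  · simp [hk, hF0]
  have hr := norm_projFreq_pos hP hk
  rcases le_total 1 ‖projFreq P k‖ with h | h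
  · have : ‖projFreq P k‖ ^ j * ‖F k‖ ≤ ‖projFreq P k‖ ^ m * ‖F k‖ := by gcongr
    have := pow_le_pow_left₀ (by positivity) this 2
    nlinarith [sq_nonneg (‖projFreq P k‖⁻¹ * ‖F k‖)]
  · have h1 : ‖projFreq P k‖ ^ j ≤ ‖projFreq P k‖⁻¹ :=
      (pow_le_one₀ hr.le h).trans ((one_le_inv₀ hr).2 h)
    have : ‖projFreq P k‖ ^ j * ‖F k‖ ≤ ‖projFreq P k‖⁻¹ * ‖F k‖ := by gcongr
    have := pow_le_pow_left₀ (by positivity) this 2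
    nlinarith [sq_nonneg (‖projFreq P k‖ ^ m * ‖F k‖)]

theorem HasSob.of_le (hP : IsProjectionMatrix P) (hF0 : F 0 = 0) {j m : ℕ} (hj : j ≤ m)
    (hneg : HasNegSob P F) (hm : HasSob P m F) : HasSob P j F :=
  Summable.of_nonneg_of_le (fun _ => by positivity) (sq_weight_le hP hF0 hj) (hneg.add hm)

theorem sobNorm_le_add (hP : IsProjectionMatrix P) (hF0 : F 0 = 0) {j m : ℕ} (hj : j ≤ m)
    (hneg : HasNegSob P F) (hm : HasSob P m F) :
    sobNorm P j F ≤ negSobNorm P F + sobNorm P m F := by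
  have hx := negSobNorm_nonneg P F
  have hz := sobNorm_nonneg P m F
  refine Real.sqrt_le_iff.2 ⟨by positivity, ?_⟩
  have h := (HasSob.of_le hP hF0 hj hneg hm).tsum_le_tsum (sq_weight_le hP hF0 hj) (hneg.add hm)
  rw [hneg.tsum_add hm, ← negSobNorm_sq, ← sobNorm_sq P m F] at h
  nlinarith

/-- AM–GM with a free weight ρ makes the multiplicative interpolation inequalities linear, so that
they can be chained. -/
theorem le_of_sq_le_mul {a x z ρ : ℝ} (hρ : 0 < ρ) (hx : 0 ≤ x) (hz : 0 ≤ z)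
    (h : a ^ 2 ≤ x * z) : a ≤ (ρ * x + ρ⁻¹ * z) / 2 := by
  refine le_of_sq_le_sq ?_ (by positivity)
  have h1 : ρ * ρ⁻¹ = 1 := mul_inv_cancel₀ hρ.ne'
  nlinarith [sq_nonneg (ρ * x - ρ⁻¹ * z)]

/-- Interpolation between consecutive orders. -/
theorem sobNorm_succ_le {j : ℕ} (h0 : HasSob P j F)
    (h2 : HasSob P (j + 2) F) {ρ : ℝ} (hρ : 0 < ρ) :
    sobNorm P (j + 1) F ≤ (ρ * sobNorm P j F + ρ⁻¹ * sobNorm P (j + 2) F) / 2 := by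
  refine le_of_sq_le_mul hρ (sobNorm_nonneg _ _ _) (sobNorm_nonneg _ _ _) ?_
  rw [sobNorm_sq]
  refine le_of_eq_of_le (tsum_congr fun k => ?_) (summable_mul_and_tsum_mul_le_sqrt
    (fun k => by positivity) (fun k => by positivity) h0 h2).2
  ring

/-- Interpolation between the orders `-1` and `1`. -/
theorem sobNorm_zero_le (hP : IsProjectionMatrix P) (hF0 : F 0 = 0) (h0 : HasNegSob P F)
    (h2 : HasSob P 1 F) {ρ : ℝ} (hρ : 0 < ρ) :
    sobNorm P 0 F ≤ (ρ * negSobNorm P F + ρ⁻¹ * sobNorm P 1 F) / 2 := by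
  refine le_of_sq_le_mul hρ (negSobNorm_nonneg _ _) (sobNorm_nonneg _ _ _) ?_
  rw [sobNorm_sq]
  refine le_of_eq_of_le (tsum_congr fun k => ?_) (summable_mul_and_tsum_mul_le_sqrt
    (fun k => by positivity) (fun k => by positivity) h0 h2).2
  by_cases hk : k = 0
  · simp [hk, hF0]
  · have := norm_projFreq_pos hP hk
    field_simp

/-- The threshold is sharp: 4⁵ = 1024 exceeds 6! = 720. -/
theorem four_pow_le_factorial {m : ℕ} (hm : 6 ≤ m) : 4 ^ m ≤ (m + 1)! := by
  induction m, hm using Nat.le_induction with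
  | base => decide
  | succ m hm ih =>
    rw [pow_succ, Nat.factorial_succ (m + 1), mul_comm]
    exact Nat.mul_le_mul (by omega) ih

/-- The interpolation inequalities that absorb the binomial coefficients of the commutator into
the factor `√(m+1)!`. -/
theorem exists_interpolation_weights (hP : IsProjectionMatrix P) (hF0 : F 0 = 0) {m : ℕ}
    (hneg : HasNegSob P F) (hm : HasSob P m F) :
    ∃ B lam mu : ℝ, 0 ≤ B ∧ (∀ j, ((m + 1).choose j : ℝ) ≤ B) ∧
      B * (1 + lam) ≤ 2 * √((m + 1)! : ℝ) ∧ B * mu ≤ √((m + 1)! : ℝ) ∧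
      ∀ i < m, sobNorm P i F ≤ lam * negSobNorm P F + mu * sobNorm P m F := by
  have hx := negSobNorm_nonneg P F
  have hz := sobNorm_nonneg P m F
  have hs : ∀ j ≤ m, HasSob P j F := fun j hj => HasSob.of_le hP hF0 hj hneg hm
  -- When B² ≤ (m+1)!, the crude bound with lam = mu = 1 suffices.
  have large : ∀ B : ℕ, (∀ j, (m + 1).choose j ≤ B) → B ^ 2 ≤ (m + 1)! →
      ∃ B lam mu : ℝ, 0 ≤ B ∧ (∀ j, ((m + 1).choose j : ℝ) ≤ B) ∧
      B * (1 + lam) ≤ 2 * √((m + 1)! : ℝ) ∧ B * mu ≤ √((m + 1)! : ℝ) ∧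
      ∀ i < m, sobNorm P i F ≤ lam * negSobNorm P F + mu * sobNorm P m F := by
    intro B hB hB2
    have h : (B : ℝ) ≤ √((m + 1)! : ℝ) := Real.le_sqrt_of_sq_le (by exact_mod_cast hB2)
    refine ⟨B, 1, 1, Nat.cast_nonneg _, fun j => by exact_mod_cast hB j, by linarith, by linarith,
      fun i hi => ?_⟩
    simpa using sobNorm_le_add hP hF0 hi.le hneg hm
  have small : ∀ M B : ℕ, (∀ j ≤ M, M.choose j ≤ B) → ∀ j, M.choose j ≤ B := by
    intro M B h j
    rcases le_or_gt j M with hj | hj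
    · exact h j hj
    · simp [Nat.choose_eq_zero_of_lt hj]
  rcases lt_or_ge m 6 with hm6 | hm6
  · interval_cases m
    · refine ⟨1, 0, 0, by norm_num, fun j => ?_, by norm_num, by norm_num, fun i hi => by omega⟩
      exact_mod_cast small 1 1 (by decide) j
    -- For m = 1, 2, 3 the largest binomial B is 2, 3, 6, above √2, √6, √24. With the rational lower
    -- bounds 1.4, 2.4, 4.8 of these roots, lam is chosen so that B(1 + lam) is exactly twice the
    -- bound.
    · have h : (1.4 : ℝ) ≤ √((1 + 1)! : ℝ) :=
        Real.le_sqrt_of_sq_le (by norm_num [Nat.factorial])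
      refine ⟨2, 0.4, 0.625, by norm_num, fun j => ?_, by linarith, by linarith, fun i hi => ?_⟩
      · exact_mod_cast small 2 2 (by decide) j
      · obtain rfl : i = 0 := by omega
        have := sobNorm_zero_le hP hF0 hneg (hs 1 le_rfl) (ρ := 0.8) (by norm_num)
        norm_num at this ⊢
        linarith
    · have h : (2.4 : ℝ) ≤ √((2 + 1)! : ℝ) :=
        Real.le_sqrt_of_sq_le (by norm_num [Nat.factorial])
      refine ⟨3, 0.6, 0.8, by norm_num, fun j => ?_, by linarith, by linarith, fun i hi => ?_⟩
      · exact_mod_cast small 3 3 (by decide) j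
      · have e0 := fun ρ hρ => sobNorm_zero_le hP hF0 hneg (hs 1 (by omega)) (ρ := ρ) hρ
        have e1 := fun ρ hρ => sobNorm_succ_le (hs 0 (by omega)) (hs 2 le_rfl) (ρ := ρ) hρ
        -- Eliminating the intermediate norms along the chain with ρ = 0.9 gives exactly lam = 0.6
        -- for i = 0; ρ = 1 serves i = 1.
        have a0 := e0 0.9 (by norm_num)
        have a1 := e1 0.9 (by norm_num)
        have b0 := e0 1 (by norm_num)
        have b1 := e1 1 (by norm_num)
        interval_cases i <;> norm_num at a0 a1 b0 b1 ⊢ <;> linarith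
    · have h : (4.8 : ℝ) ≤ √((3 + 1)! : ℝ) :=
        Real.le_sqrt_of_sq_le (by norm_num [Nat.factorial])
      refine ⟨6, 0.6, 0.8, by norm_num, fun j => ?_, by linarith, by linarith, fun i hi => ?_⟩
      · exact_mod_cast small 4 6 (by decide) j
      · have e0 := fun ρ hρ => sobNorm_zero_le hP hF0 hneg (hs 1 (by omega)) (ρ := ρ) hρ
        have e1 := fun ρ hρ => sobNorm_succ_le (hs 0 (by omega)) (hs 2 (by omega)) (ρ := ρ) hρ
        have e2 := fun ρ hρ => sobNorm_succ_le (hs 1 (by omega)) (hs 3 le_rfl) (ρ := ρ) hρ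
        have a0 := e0 0.8 (by norm_num)
        have a1 := e1 0.8 (by norm_num)
        have a2 := e2 0.8 (by norm_num)
        have b0 := e0 1 (by norm_num)
        have b1 := e1 1 (by norm_num)
        have b2 := e2 1 (by norm_num)
        interval_cases i <;> norm_num at a0 a1 a2 b0 b1 b2 ⊢ <;> linarith
    -- Central binomials: 10² ≤ 5! = 120, and next 20² ≤ 6! = 720.
    · exact large 10 (small 5 10 (by decide)) (by decide)
    · exact large 20 (small 6 20 (by decide)) (by decide)
  -- By Pascal's rule C(m+1, j+1) is a sum of two distinct entries of row m, hence at most 2^m.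
  · refine large (2 ^ m) (fun j => ?_) ?_
    · rcases j with _ | j
      · simpa using Nat.one_le_two_pow
      · rw [Nat.choose_succ_succ]
        rcases lt_or_ge m (j + 1) with h | h
        · rw [Nat.choose_eq_zero_of_lt h, add_zero]; exact Nat.choose_le_two_pow m j
        · rw [← Nat.sum_range_choose]
          have h2 : ({j, j + 1} : Finset ℕ) ⊆ Finset.range (m + 1) := by
            intro i hi
            simp only [Finset.mem_insert, Finset.mem_singleton] at hi
            rw [Finset.mem_range]; omega
          have h3 := Finset.sum_le_sum_of_subset (f := fun i => m.choose i) h2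
          rwa [Finset.sum_pair (by omega)] at h3
    · rw [← pow_mul, mul_comm, pow_mul]
      exact four_pow_le_factorial hm6

end Interpolation

/-! ### The recursion for the constants. -/

section Constants

theorem regM_eq_sum_range (d : ℕ) (α₀ : ℝ) (c : ℕ → ℝ) (m : ℕ) :
    regM d α₀ c m = max (α₀⁻¹ * c (m + 1) + 2 * ∑ j ∈ Finset.range m,
        √((j + 1 + d - 1).choose (d - 1) : ℝ) * c (m + 1 - (j + 1)) * regConst d α₀ c j)
      (1 + ∑ j ∈ Finset.range m,
        √((j + 1 + d - 1).choose (d - 1) : ℝ) * c (m + 1 - (j + 1)) * regConst d α₀ c j) := by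
  have key : ∀ f : ℕ → ℝ, ∑ j ∈ Finset.Icc 1 m, f j = ∑ j ∈ Finset.range m, f (j + 1) := by
    intro f
    rw [Finset.range_eq_Ico, Finset.sum_Ico_add' f 0 m 1]
    rfl
  rw [regM, key]
  rfl

theorem one_le_regM_and_regConst_nonneg {d : ℕ} {α₀ : ℝ} {c : ℕ → ℝ} (hα₀ : 0 < α₀)
    (hc : ∀ j, 0 ≤ c j) (m : ℕ) : 1 ≤ regM d α₀ c m ∧ 0 ≤ regConst d α₀ c m := by
  induction m using Nat.strong_induction_on with
  | _ m ih =>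
    have h1 : 1 ≤ regM d α₀ c m := by
      rw [regM_eq_sum_range]
      refine le_max_of_le_right (le_add_of_nonneg_right (Finset.sum_nonneg fun j hj => ?_))
      exact mul_nonneg (mul_nonneg (Real.sqrt_nonneg _) (hc _)) (ih j (Finset.mem_range.1 hj)).2
    refine ⟨h1, ?_⟩
    rw [regConst_eq]
    positivity

/-- The bound for the solution that results from the energy estimate has the constant of the
recursion. -/
theorem le_regConst_mul {d m : ℕ} (hd : 0 < d) {α₀ : ℝ} {c : ℕ → ℝ} (hα₀ : 0 < α₀)
    (hc : ∀ j, 0 ≤ c j) {B lam mu x z : ℝ} {f u : ℕ → ℝ} (hx : 0 ≤ x) (hz : 0 ≤ z)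
    (hB0 : 0 ≤ B) (hB : ∀ j, ((m + 1).choose j : ℝ) ≤ B)
    (hB1 : B * (1 + lam) ≤ 2 * √((m + 1)! : ℝ)) (hB2 : B * mu ≤ √((m + 1)! : ℝ))
    (hf0 : ∀ i, 0 ≤ f i) (hf : ∀ i < m, f i ≤ lam * x + mu * z) (hu0 : u 0 ≤ α₀⁻¹ * x)
    (hu : ∀ i < m, u (i + 1) ≤ regConst d α₀ c i * (x + f i)) :
    α₀⁻¹ * (z + ∑ j ∈ Finset.range (m + 1), ((m + 1).choose j : ℝ) * c (m + 1 - j) * u j) ≤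
      regConst d α₀ c m * (x + z) := by
  -- In the application x = ‖F‖₋₁, z = ‖F‖_m, f i = ‖F‖_i and u i = ‖U‖_{i+1}.
  set K := √((m + 1)! : ℝ) with hK
  have hK1 : 1 ≤ K := Real.one_le_sqrt.2 (by exact_mod_cast (m + 1).factorial_pos)
  have hC := fun i => (one_le_regM_and_regConst_nonneg (d := d) hα₀ hc i).2
  set S := ∑ j ∈ Finset.range m,
        √((j + 1 + d - 1).choose (d - 1) : ℝ) * c (m + 1 - (j + 1)) * regConst d α₀ c j with hS
  have hS0 : 0 ≤ S := Finset.sum_nonneg fun j _ =>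
    mul_nonneg (mul_nonneg (Real.sqrt_nonneg _) (hc _)) (hC j)
  set a := α₀⁻¹ * c (m + 1) with ha
  have ha0 : 0 ≤ a := mul_nonneg (inv_nonneg.2 hα₀.le) (hc _)
  have hsum : ∑ j ∈ Finset.range m, ((m + 1).choose (j + 1) : ℝ) * c (m + 1 - (j + 1)) * u (j + 1)
      ≤ (K * 2 * x + K * z) * S := by
    rw [hS, Finset.mul_sum]
    refine Finset.sum_le_sum fun j hj => ?_
    have hj := Finset.mem_range.1 hj
    -- The dimensional factors, here and √d below, enter only as numbers ≥ 1.
    have h1 : (1 : ℝ) ≤ √((j + 1 + d - 1).choose (d - 1) : ℝ) :=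
      Real.one_le_sqrt.2 (by exact_mod_cast Nat.choose_pos (by omega))
    have hxf : 0 ≤ x + f j := add_nonneg hx (hf0 j)
    have h2 : B * (x + f j) ≤ K * 2 * x + K * z := by
      have := mul_le_mul_of_nonneg_left (hf j hj) hB0
      nlinarith [mul_le_mul_of_nonneg_right hB1 hx, mul_le_mul_of_nonneg_right hB2 hz]
    have hcj := hc (m + 1 - (j + 1))
    have hq : 0 ≤ c (m + 1 - (j + 1)) * regConst d α₀ c j := mul_nonneg hcj (hC j)
    calc ((m + 1).choose (j + 1) : ℝ) * c (m + 1 - (j + 1)) * u (j + 1)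
        ≤ ((m + 1).choose (j + 1) : ℝ) * c (m + 1 - (j + 1)) *
            (regConst d α₀ c j * (x + f j)) :=
          mul_le_mul_of_nonneg_left (hu j hj) (mul_nonneg (Nat.cast_nonneg _) hcj)
      _ = ((m + 1).choose (j + 1) : ℝ) * ((x + f j) *
            (c (m + 1 - (j + 1)) * regConst d α₀ c j)) := by ring
      _ ≤ B * ((x + f j) * (c (m + 1 - (j + 1)) * regConst d α₀ c j)) :=
          mul_le_mul_of_nonneg_right (hB _) (mul_nonneg hxf hq)
      _ = (B * (x + f j)) * (c (m + 1 - (j + 1)) * regConst d α₀ c j) := by ring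
      _ ≤ (K * 2 * x + K * z) * (√((j + 1 + d - 1).choose (d - 1) : ℝ) *
            (c (m + 1 - (j + 1)) * regConst d α₀ c j)) :=
          mul_le_mul h2 (le_mul_of_one_le_left hq h1) hq (by positivity)
      _ = _ := by ring
  have hzero : ((m + 1).choose 0 : ℝ) * c (m + 1 - 0) * u 0 ≤ a * x := by
    rw [Nat.choose_zero_right, Nat.sub_zero, Nat.cast_one, one_mul, ha]
    calc c (m + 1) * u 0 ≤ c (m + 1) * (α₀⁻¹ * x) := mul_le_mul_of_nonneg_left hu0 (hc _)
      _ = _ := by ring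
  -- Since K ≥ 1, the left side is at most α₀⁻¹K((a + 2S)x + (1 + S)z): the entries of the maximum
  -- are the coefficients of x and z.
  have hM1 : a + 2 * S ≤ regM d α₀ c m := by rw [regM_eq_sum_range]; exact le_max_left _ _
  have hM2 : 1 + S ≤ regM d α₀ c m := by rw [regM_eq_sum_range]; exact le_max_right _ _
  have hd1 : 1 ≤ √(d : ℝ) := Real.one_le_sqrt.2 (by exact_mod_cast hd)
  have hM0 : 0 ≤ regM d α₀ c m := by linarith
  rw [Finset.sum_range_succ', regConst_eq]
  calc α₀⁻¹ * (z + (∑ j ∈ Finset.range m, ((m + 1).choose (j + 1) : ℝ) * c (m + 1 - (j + 1)) *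
          u (j + 1) + ((m + 1).choose 0 : ℝ) * c (m + 1 - 0) * u 0))
      ≤ α₀⁻¹ * (K * (regM d α₀ c m * (x + z))) := by
        refine mul_le_mul_of_nonneg_left ?_ (inv_nonneg.2 hα₀.le)
        have h3 := mul_le_mul_of_nonneg_right hM1 (mul_nonneg (zero_le_one.trans hK1) hx)
        have h4 := mul_le_mul_of_nonneg_right hM2 (mul_nonneg (zero_le_one.trans hK1) hz)
        have h5 := mul_le_mul_of_nonneg_right hK1 (mul_nonneg ha0 hx)
        have h6 := mul_le_mul_of_nonneg_right hK1 hz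
        nlinarith
    _ ≤ α₀⁻¹ * ((K * √(d : ℝ)) * (regM d α₀ c m * (x + z))) := by
        refine mul_le_mul_of_nonneg_left ?_ (inv_nonneg.2 hα₀.le)
        exact mul_le_mul_of_nonneg_right (le_mul_of_one_le_right (by positivity) hd1)
          (mul_nonneg hM0 (add_nonneg hx hz))
    _ = _ := by ring

end Constants

/-! ### Translation to `HBar` and the induction on m. -/

theorem rpow_two_mul_mul_sq {r u : ℝ} (hr : 0 ≤ r) (s : ℝ) :
    r ^ (2 * s) * u ^ 2 = (r ^ s * u) ^ 2 := by
  rw [mul_comm 2 s, Real.rpow_mul hr, Real.rpow_two, mul_pow]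

/-- The sum may run over all frequencies only because U 0 = 0: for s = 0 the weight at k = 0 is `0 ^
0 = 1`. -/
theorem mem_HBar_iff {s : ℝ} {U : (Fin n → ℤ) → ℂ} :
    U ∈ HBar P s ↔ U 0 = 0 ∧ Summable fun k => (‖projFreq P k‖ ^ s * ‖U k‖) ^ 2 := by
  refine and_congr_right fun h0 => ?_
  rw [summable_iff_summable_ne_zero (by simp [h0])]
  simp only [rpow_two_mul_mul_sq (norm_nonneg _)]

theorem hNorm_eq {s : ℝ} {U : (Fin n → ℤ) → ℂ} (h0 : U 0 = 0) :
    hNorm P s U = √(∑' k, (‖projFreq P k‖ ^ s * ‖U k‖) ^ 2) := by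
  rw [hNorm, tsum_eq_tsum_ne_zero (by simp [h0])]
  simp only [rpow_two_mul_mul_sq (norm_nonneg _)]

theorem mem_HBar_natCast_iff {m : ℕ} {U : (Fin n → ℤ) → ℂ} :
    U ∈ HBar P (m : ℝ) ↔ U 0 = 0 ∧ HasSob P m U := by
  simp only [mem_HBar_iff, HasSob, Real.rpow_natCast]

theorem hNorm_natCast {m : ℕ} {U : (Fin n → ℤ) → ℂ} (h0 : U 0 = 0) :
    hNorm P (m : ℝ) U = sobNorm P m U := by
  simp only [hNorm_eq h0, sobNorm, Real.rpow_natCast]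

theorem mem_HBar_one_iff {U : (Fin n → ℤ) → ℂ} :
    U ∈ HBar P 1 ↔ U 0 = 0 ∧ HasL2Grad P U := by
  simp only [mem_HBar_iff, HasL2Grad, Real.rpow_one]

theorem mem_HBar_neg_one_iff {U : (Fin n → ℤ) → ℂ} :
    U ∈ HBar P (-1) ↔ U 0 = 0 ∧ HasNegSob P U := by
  simp only [mem_HBar_iff, HasNegSob, Real.rpow_neg_one]

theorem hNorm_neg_one {U : (Fin n → ℤ) → ℂ} (h0 : U 0 = 0) :
    hNorm P (-1) U = negSobNorm P U := by
  simp only [hNorm_eq h0, negSobNorm, Real.rpow_neg_one]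

theorem pairing_eq_tsum {F V : (Fin n → ℤ) → ℂ} (hF0 : F 0 = 0) :
    pairing F V = ∑' k, F k * conj (V k) := by
  rw [pairing, tsum_eq_tsum_ne_zero (by simp [hF0])]

/-- Regularity of the solution of the variational problem, with the recursively defined
constants. -/
theorem hasSob_add_two_and_sobNorm_le_regConst (hP : IsProjectionMatrix P) (hd : 0 < d)
    {A : Torus n → ℝ} {α₀ α₁ : ℝ} (hA : AEMeasurable A (torusMeasure n)) (hα₀ : 0 < α₀)
    (hAb : ∀ y, α₀ ≤ A y ∧ A y ≤ α₁) {N CA : ℝ} (hCA : 0 < CA)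
    (hdecay : ∀ k : Fin n → ℤ, ‖fourierCoeffTorus A k‖ ≤ CA * (1 + freqNorm k) ^ (-N))
    {F U : (Fin n → ℤ) → ℂ} (hF0 : F 0 = 0) (hneg : HasNegSob P F) (hU0 : U 0 = 0)
    (hU : HasL2Grad P U)
    (heq : ∀ V, V 0 = 0 → HasL2Grad P V → energyForm P A U V = ∑' k, F k * conj (V k))
    (m : ℕ) (hN : (n : ℝ) + m + 1 < N) (hF : HasSob P m F) :
    HasSob P (m + 2) U ∧ sobNorm P (m + 2) U ≤
      regConst d α₀ (derivConst P CA N) m * (negSobNorm P F + sobNorm P m F) := by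
  -- The commutator at level m involves U in orders 1 to m + 1: order 1 is the energy bound, the
  -- others are earlier levels.
  induction m using Nat.strong_induction_on with
  | _ m ih =>
    have hFs : ∀ j ≤ m, HasSob P j F := fun j hj => HasSob.of_le hP hF0 hj hneg hF
    have hprev : ∀ i < m, HasSob P (i + 2) U ∧ sobNorm P (i + 2) U ≤
        regConst d α₀ (derivConst P CA N) i * (negSobNorm P F + sobNorm P i F) := by
      intro i hi
      refine ih i hi ?_ (hFs i hi.le)
      have : (i : ℝ) < m := by exact_mod_cast hi
      linarith
    have hder := fun j (hj : j ≤ m + 1) =>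
      summable_and_tsum_mul_norm_projFreq_pow_le (P := P) (j := j) hCA.le (by
        have : (j : ℝ) ≤ m + 1 := by exact_mod_cast hj
        linarith) hdecay
    have hUs : ∀ j ≤ m, HasSob P (j + 1) U := by
      rintro (_ | j) hj
      · exact hasSob_one.2 hU
      · exact (hprev j hj).1
    obtain ⟨h1, h2⟩ := hasSob_add_two_and_sobNorm_le hA hα₀ hAb (fun j hj => (hder j hj).1) hF hUs
      heq hU0
    refine ⟨h1, h2.trans ?_⟩
    obtain ⟨B, lam, mu, hB0, hB, hB1, hB2, hf⟩ := exists_interpolation_weights hP hF0 hneg hF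
    refine le_trans ?_ (le_regConst_mul (f := fun i => sobNorm P i F)
      (u := fun i => sobNorm P (i + 1) U) hd hα₀ (fun j => derivConst_nonneg hCA.le j)
      (negSobNorm_nonneg P F) (sobNorm_nonneg P m F) hB0 hB hB1 hB2
      (fun i => sobNorm_nonneg P i F) hf ?_ fun i hi => (hprev i hi).2)
    · refine mul_le_mul_of_nonneg_left ?_ (inv_nonneg.2 hα₀.le)
      refine add_le_add le_rfl (Finset.sum_le_sum fun j _ => ?_)
      exact mul_le_mul_of_nonneg_right
        (mul_le_mul_of_nonneg_left (hder _ (Nat.sub_le _ _)).2 (Nat.cast_nonneg _))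
        (sobNorm_nonneg _ _ _)
    · rw [zero_add, sobNorm_one]
      exact gradNorm_le_of_energyForm_eq hP hA hα₀ hAb hF0 hneg hU (heq U hU0 hU)

end Quasiperiodic

end

/-! ### Assembly of the theorem. -/

theorem theorem3p1 {d n : ℕ} (P : Matrix (Fin d) (Fin n) ℝ)
    (hP : Quasiperiodic.IsProjectionMatrix P)
    (A : Quasiperiodic.Torus n → ℝ) (hA : AEMeasurable A (Quasiperiodic.torusMeasure n))
    (α₀ α₁ : ℝ) (hα₀ : 0 < α₀) (hAbound : ∀ y, α₀ ≤ A y ∧ A y ≤ α₁)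
    (m : ℕ) (N CA : ℝ) (hCA : 0 < CA) (hN : (n : ℝ) + m + 1 < N)
    (hdecay : ∀ k : Fin n → ℤ,
      ‖Quasiperiodic.fourierCoeffTorus A k‖ ≤ CA * (1 + Quasiperiodic.freqNorm k) ^ (-N))
    (F : (Fin n → ℤ) → ℂ)
    (hF : F ∈ Quasiperiodic.HBar P (-1) ⊓ Quasiperiodic.HBar P (m : ℝ)) :
    ∃ U ∈ Quasiperiodic.HBar P 1 ⊓ Quasiperiodic.HBar P ((m : ℝ) + 2),
      Quasiperiodic.IsVariationalSolution P A F U ∧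
      (∀ W, Quasiperiodic.IsVariationalSolution P A F W → W = U) ∧
      Quasiperiodic.hNorm P ((m : ℝ) + 2) U ≤
        Quasiperiodic.regConst d α₀ (Quasiperiodic.derivConst P CA N) m *
          (Quasiperiodic.hNorm P (-1) F + Quasiperiodic.hNorm P (m : ℝ) F) := by
  open Quasiperiodic in
  obtain ⟨hF1, hF2⟩ := hF
  obtain ⟨hF0, hneg⟩ := mem_HBar_neg_one_iff.1 hF1
  obtain ⟨-, hFm⟩ := mem_HBar_natCast_iff.1 hF2
  obtain ⟨U, hU0, hU, heq⟩ := exists_energyForm_eq hP hA hα₀ hAbound hF0 hneg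
  have hsum : Summable fun k => ‖fourierCoeffTorus A k‖ := by
    have h := (summable_and_tsum_mul_norm_projFreq_pow_le (P := P) (j := 0) hCA.le (by
      have : (0 : ℝ) ≤ m := m.cast_nonneg
      push_cast
      linarith) hdecay).1
    simpa using h
  have hreg : HasSob P (m + 2) U ∧ sobNorm P (m + 2) U ≤
      regConst d α₀ (derivConst P CA N) m * (negSobNorm P F + sobNorm P m F) := by
    -- For d = 0, independence of the columns leaves only k = 0, so U = 0; the constant also
    -- vanishes through √d.
    rcases d.eq_zero_or_pos with rfl | hd
    · have hzero : U = 0 := by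
        ext k
        by_cases hk : k = 0
        · rw [hk, hU0]; rfl
        · exact absurd (Subsingleton.elim _ _) (projFreq_ne_zero hP hk)
      subst hzero
      exact ⟨by simp [HasSob], by simp [sobNorm, regConst_eq]⟩
    · exact hasSob_add_two_and_sobNorm_le_regConst hP hd hA hα₀ hAbound hCA hdecay hF0 hneg hU0 hU
        heq m hN hFm
  have hcast : (m : ℝ) + 2 = ((m + 2 : ℕ) : ℝ) := by push_cast; ring
  refine ⟨U, ⟨mem_HBar_one_iff.2 ⟨hU0, hU⟩, ?_⟩, ⟨mem_HBar_one_iff.2 ⟨hU0, hU⟩, fun V hV => ?_⟩,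
    fun W hW => ?_, ?_⟩
  · rw [hcast]
    exact mem_HBar_natCast_iff.2 ⟨hU0, hreg.1⟩
  · obtain ⟨hV0, hV⟩ := mem_HBar_one_iff.1 hV
    rw [heq V hV0 hV, pairing_eq_tsum hF0]
  · obtain ⟨hW1, hW2⟩ := hW
    obtain ⟨hW0, hWg⟩ := mem_HBar_one_iff.1 hW1
    refine eq_of_energyForm_eq hP hA hα₀ hAbound hU0 hW0 hU hWg hsum fun V hV0 hV => ?_
    rw [hW2 V (mem_HBar_one_iff.2 ⟨hV0, hV⟩), heq V hV0 hV, pairing_eq_tsum hF0]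
  · rw [hcast, hNorm_natCast hU0, hNorm_neg_one hF0, hNorm_natCast hF0]
    exact hreg.2
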